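/- Let $M$ be a smooth manifold of dimension $p+q$ with a smooth foliation $\mathcal F$ of codimension $q$, let $N=N(M,\mathcal F)=TM/T\mathcal F$ be its normal bundle, with projection $\pi:N\to M$, and let $D$ be a foliated flat torsion-free connection in $N$ (so $\mathcal F$ is transversely affine); that is, $M$ is covered by adapted charts $(x^1,\dots,x^p,y^1,\dots,y^q)$ (with $T\mathcal F$ spanned by the $\partial/\partial x^i$) in which the classes $\overline{\partial/\partial y^j}$ are $D$-parallel sections of $N$. Such adapted charts are called affine. Let $g$ be a foliated metric, i.e. a smooth Riemannian metric on $N$ whose components $g_{ij}$ in adapted charts depend locally only on $y$. An adapted chart $(x,y)$ of $M$ induces a chart $(x,y,dy)$ of the manifold $N$, where $dy^1,\dots,dy^q$ are the fibre coordinates; let $\mathcal F_N$ be the foliation of $N$, of codimension $2q$, for which these charts are adapted, with transverse coordinates $(y,dy)$. Let $J_N$ be the complex structure on the normal bundle of $\mathcal F_N$ which is multiplication by $\sqrt{-1}$ in the transverse coordinates $z^i=y^i+\sqrt{-1}\,dy^i$ induced by affine adapted charts, and let $$g^N=\sum_{i,j}(g_{ij}\circ\pi)\,dz^i\,d\bar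 z^j=\sum_{i,j}(g_{ij}\circ\pi)\bigl(dy^i\,dy^j+d(dy^i)\,d(dy^j)\bigr)$$ in these coordinates. Then the following conditions are equivalent: (1) $g$ is a foliated Hessian metric on $(M,\mathcal F,D)$: around every point of $M$ there are an affine adapted chart $(x,y)$ and a smooth function $h$ of $y$ with $g_{ij}=\dfrac{\partial^2 h}{\partial y^i\partial y^j}$; (2) $g^N$ is a foliated Kähler metric on $(N,\mathcal F_N,J_N)$: $J_N$ is a foliated integrable complex structure (around every point of $N$ there are transversely holomorphic adapted coordinates), $g^N$ is a foliated metric on the normal bundle of $\mathcal F_N$ which is Hermitian for $J_N$, and its fundamental form $\omega(X,Y)=g^N(J_NX,Y)$ is closed. -/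

import Mathlib

open Set Filter Topology Bundle
open scoped Manifold ContDiff

noncomputable section

section Foliations

variable {E : Type*} [NormedAddCommGroup E] [NormedSpace ℝ E]
  {H : Type*} [TopologicalSpace H] {I : ModelWithCorners ℝ E H}
  {M : Type*} [TopologicalSpace M] [ChartedSpace H M]
  {P : Type*} [NormedAddCommGroup P] [NormedSpace ℝ P]
  {Q : Type*} [NormedAddCommGroup Q] [NormedSpace ℝ Q]

/-- A smooth chart `φ = (x, y)` of `M` with values in `P × Q` (leaf coordinates `x`, transverse
coordinates `y`) is adapted to the distribution `T` if `T = ker dy` on the domain of `φ`, that is,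
if `T` is spanned there by the fields `∂/∂x`. -/
structure IsAdaptedChart (I : ModelWithCorners ℝ E H) (T : ∀ x : M, Submodule ℝ (TangentSpace I x))
    (φ : OpenPartialHomeomorph M (P × Q)) : Prop where
  contMDiffOn : ContMDiffOn I 𝓘(ℝ, P × Q) ∞ φ φ.source
  contMDiffOn_symm : ContMDiffOn 𝓘(ℝ, P × Q) I ∞ φ.symm φ.target
  mem_iff : ∀ x ∈ φ.source, ∀ v : TangentSpace I x,
    v ∈ T x ↔ (mfderiv I 𝓘(ℝ, P × Q) φ x v : P × Q).2 = 0

/-- A foliation of the manifold `M`, with leaves modelled on `P` and transversals modelled on `Q`: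
a completely integrable subbundle of the tangent bundle, i.e. a field of subspaces such that `M` is
covered by adapted charts. -/
structure Foliation (I : ModelWithCorners ℝ E H) (M : Type*) [TopologicalSpace M] [ChartedSpace H M]
    (P : Type*) [NormedAddCommGroup P] [NormedSpace ℝ P]
    (Q : Type*) [NormedAddCommGroup Q] [NormedSpace ℝ Q] where
  tangent : ∀ x : M, Submodule ℝ (TangentSpace I x)
  exists_chart : ∀ x : M, ∃ φ : OpenPartialHomeomorph M (P × Q),
    x ∈ φ.source ∧ IsAdaptedChart I tangent φ

namespace Foliation

/-- The fibre `T_x M / T_x F` of the normal bundle of the foliation `F`. -/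
def NormalSpace (F : Foliation I M P Q) (x : M) : Type _ := TangentSpace I x ⧸ F.tangent x

variable (F : Foliation I M P Q)

instance (x : M) : AddCommGroup (F.NormalSpace x) :=
  inferInstanceAs (AddCommGroup (TangentSpace I x ⧸ F.tangent x))

instance (x : M) : Module ℝ (F.NormalSpace x) :=
  inferInstanceAs (Module ℝ (TangentSpace I x ⧸ F.tangent x))

instance (x : M) : TopologicalSpace (F.NormalSpace x) :=
  inferInstanceAs (TopologicalSpace (TangentSpace I x ⧸ F.tangent x))

instance (x : M) : IsTopologicalAddGroup (F.NormalSpace x) :=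
  inferInstanceAs (IsTopologicalAddGroup (TangentSpace I x ⧸ F.tangent x))

instance (x : M) : ContinuousSMul ℝ (F.NormalSpace x) :=
  inferInstanceAs (ContinuousSMul ℝ (TangentSpace I x ⧸ F.tangent x))

/-- The projection of the tangent space onto the normal space. -/
def toNormal (x : M) : TangentSpace I x →L[ℝ] F.NormalSpace x := (F.tangent x).mkQL

/-- The map induced on the normal space by a linear map vanishing on the leaves. -/
def liftNormal (x : M) (f : TangentSpace I x →L[ℝ] Q) (hf : F.tangent x ≤ f.ker) :
    F.NormalSpace x →L[ℝ] Q :=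
  (F.tangent x).liftQL f hf

/-- The charts of `M` adapted to the foliation. -/
structure AdaptedChart where
  toChart : OpenPartialHomeomorph M (P × Q)
  isAdapted : IsAdaptedChart I F.tangent toChart

/-- A chosen adapted chart around a point. -/
def chartAround (x : M) : F.AdaptedChart where
  toChart := (F.exists_chart x).choose
  isAdapted := (F.exists_chart x).choose_spec.2

lemma mem_chartAround (x : M) : x ∈ (F.chartAround x).toChart.source :=
  (F.exists_chart x).choose_spec.1

namespace AdaptedChart

variable {F} (φ : F.AdaptedChart)

lemma mdifferentiable : φ.toChart.MDifferentiable I 𝓘(ℝ, P × Q) :=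
  ⟨φ.isAdapted.contMDiffOn.mdifferentiableOn (by simp),
    φ.isAdapted.contMDiffOn_symm.mdifferentiableOn (by simp)⟩

/-- The differential of the transverse coordinates. -/
def tdiff (x : M) : TangentSpace I x →L[ℝ] Q :=
  (ContinuousLinearMap.snd ℝ P Q).comp
    (mfderiv I 𝓘(ℝ, P × Q) φ.toChart x : TangentSpace I x →L[ℝ] P × Q)

lemma tangent_le_ker {x : M} (hx : x ∈ φ.toChart.source) : F.tangent x ≤ (φ.tdiff x).ker :=
  fun v hv => (φ.isAdapted.mem_iff x hx v).1 hv

open Classical in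
/-- The transverse coordinates `dy(v)` of a normal vector `v` at the point `x` of the domain of the
chart (with value `0` outside of the domain). -/
def dy (x : M) : F.NormalSpace x →L[ℝ] Q :=
  if hx : x ∈ φ.toChart.source then
    F.liftNormal x (φ.tdiff x) (φ.tangent_le_ker hx)
  else 0

/-- The normal vector `∑ aⁱ ∂/∂yⁱ` at `x` (the class of this tangent vector modulo the tangent space
of the leaf), where `y` are the transverse coordinates of the chart. -/
def frame (x : M) : Q →L[ℝ] F.NormalSpace x :=
  (F.toNormal x).comp ((mfderiv 𝓘(ℝ, P × Q) I φ.toChart.symm (φ.toChart x) :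
    P × Q →L[ℝ] TangentSpace I x).comp (ContinuousLinearMap.inr ℝ P Q))

lemma dy_toNormal {x : M} (hx : x ∈ φ.toChart.source) (v : TangentSpace I x) :
    φ.dy x (F.toNormal x v) = (mfderiv I 𝓘(ℝ, P × Q) φ.toChart x v : P × Q).2 := by
  rw [dy, dif_pos hx]
  rfl

lemma mfderiv_symm_mfderiv {x : M} (hx : x ∈ φ.toChart.source) (v : TangentSpace I x) :
    (mfderiv 𝓘(ℝ, P × Q) I φ.toChart.symm (φ.toChart x) :
      P × Q →L[ℝ] TangentSpace I x) (mfderiv I 𝓘(ℝ, P × Q) φ.toChart x v) = v :=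
  DFunLike.congr_fun (φ.mdifferentiable.symm_comp_deriv hx) v

lemma mfderiv_mfderiv_symm {x : M} (hx : x ∈ φ.toChart.source) (w : P × Q) :
    (mfderiv I 𝓘(ℝ, P × Q) φ.toChart x : TangentSpace I x →L[ℝ] P × Q)
      ((mfderiv 𝓘(ℝ, P × Q) I φ.toChart.symm (φ.toChart x) :
      P × Q →L[ℝ] TangentSpace I x) w) = w := by
  have h := φ.mdifferentiable.comp_symm_deriv (φ.toChart.map_source hx)
  rw [φ.toChart.left_inv hx] at h
  exact DFunLike.congr_fun h w

lemma dy_frame {x : M} (hx : x ∈ φ.toChart.source) (a : Q) : φ.dy x (φ.frame x a) = a := by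
  change φ.dy x (F.toNormal x _) = a
  rw [φ.dy_toNormal hx]
  exact congrArg Prod.snd (φ.mfderiv_mfderiv_symm hx (0, a))

lemma frame_dy {x : M} (hx : x ∈ φ.toChart.source) (v : F.NormalSpace x) :
    φ.frame x (φ.dy x v) = v := by
  obtain ⟨v, rfl⟩ := Submodule.Quotient.mk_surjective _ v
  change φ.frame x (φ.dy x (F.toNormal x v)) = F.toNormal x v
  rw [φ.dy_toNormal hx]
  refine (Submodule.Quotient.eq _).2 ((φ.isAdapted.mem_iff x hx _).2 ?_)
  have h := φ.mfderiv_mfderiv_symm hx (0, (mfderiv I 𝓘(ℝ, P × Q) φ.toChart x v : P × Q).2)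
  rw [map_sub]
  change _ - _ = (0 : Q)
  have h2 := congrArg Prod.snd h
  exact sub_eq_zero.2 h2

/-- The expression of the transverse coordinates of `ψ` in the coordinates of `φ`. -/
def transition (φ ψ : F.AdaptedChart) (z : P × Q) : Q := (ψ.toChart (φ.toChart.symm z)).2

lemma isOpen_transition (φ ψ : F.AdaptedChart) :
    IsOpen (φ.toChart.target ∩ φ.toChart.symm ⁻¹' ψ.toChart.source) :=
  φ.toChart.symm.isOpen_inter_preimage ψ.toChart.open_source

lemma contDiffOn_transition (φ ψ : F.AdaptedChart) : ContDiffOn ℝ ∞ (transition φ ψ)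
    (φ.toChart.target ∩ φ.toChart.symm ⁻¹' ψ.toChart.source) := by
  have h : ContMDiffOn 𝓘(ℝ, P × Q) 𝓘(ℝ, P × Q) ∞ (ψ.toChart ∘ φ.toChart.symm)
      (φ.toChart.target ∩ φ.toChart.symm ⁻¹' ψ.toChart.source) :=
    ψ.isAdapted.contMDiffOn.comp (φ.isAdapted.contMDiffOn_symm.mono inter_subset_left)
      inter_subset_right
  exact (contMDiffOn_iff_contDiffOn.1 h).snd

lemma fderiv_transition (φ ψ : F.AdaptedChart) {x : M} (hx : x ∈ φ.toChart.source)
    (hx' : x ∈ ψ.toChart.source) (w : P × Q) :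
    fderiv ℝ (transition φ ψ) (φ.toChart x) w =
      (mfderiv I 𝓘(ℝ, P × Q) ψ.toChart x ((mfderiv 𝓘(ℝ, P × Q) I φ.toChart.symm (φ.toChart x) :
        P × Q →L[ℝ] TangentSpace I x) w) : P × Q).2 := by
  have hz : φ.toChart.symm (φ.toChart x) = x := φ.toChart.left_inv hx
  have h1 : MDifferentiableAt 𝓘(ℝ, P × Q) I φ.toChart.symm (φ.toChart x) :=
    φ.mdifferentiable.mdifferentiableAt_symm (φ.toChart.map_source hx)
  have h2 : MDifferentiableAt I 𝓘(ℝ, P × Q) ψ.toChart (φ.toChart.symm (φ.toChart x)) := by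
    rw [hz]; exact ψ.mdifferentiable.mdifferentiableAt hx'
  have h3 := mfderiv_comp (φ.toChart x) h2 h1
  have h4 := (h2.comp _ h1).differentiableAt
  rw [mfderiv_eq_fderiv] at h3
  have h5 : fderiv ℝ (transition φ ψ) (φ.toChart x) = (ContinuousLinearMap.snd ℝ P Q).comp
      (fderiv ℝ (ψ.toChart ∘ φ.toChart.symm) (φ.toChart x)) := h4.hasFDerivAt.snd.fderiv
  rw [h5, h3, hz]
  rfl

lemma dy_frame_transition (φ ψ : F.AdaptedChart) {x : M} (hx : x ∈ φ.toChart.source)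
    (hx' : x ∈ ψ.toChart.source) (a : Q) :
    ψ.dy x (φ.frame x a) = fderiv ℝ (transition φ ψ) (φ.toChart x) (0, a) := by
  rw [fderiv_transition φ ψ hx hx']
  exact ψ.dy_toNormal hx' _

/-- The coordinate change of the normal bundle between two adapted charts: the Jacobian matrix of the
change of transverse coordinates. -/
def coordChange (φ ψ : F.AdaptedChart) (x : M) : Q →L[ℝ] Q :=
  (fderiv ℝ (transition φ ψ) (φ.toChart x)).comp (ContinuousLinearMap.inr ℝ P Q)

lemma contMDiffOn_coordChange (φ ψ : F.AdaptedChart) :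
    ContMDiffOn I 𝓘(ℝ, Q →L[ℝ] Q) ∞ (coordChange φ ψ)
      (φ.toChart.source ∩ ψ.toChart.source) := by
  have h1 : ContDiffOn ℝ ∞ (fun z => (fderiv ℝ (transition φ ψ) z).comp
      (ContinuousLinearMap.inr ℝ P Q))
      (φ.toChart.target ∩ φ.toChart.symm ⁻¹' ψ.toChart.source) :=
    ((contDiffOn_transition φ ψ).fderiv_of_isOpen (isOpen_transition φ ψ) (by simp)).clm_comp
      contDiffOn_const
  refine h1.contMDiffOn.comp (φ.isAdapted.contMDiffOn.mono inter_subset_left) ?_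
  rintro x ⟨hx, hx'⟩
  refine ⟨φ.toChart.map_source hx, ?_⟩
  rw [mem_preimage, φ.toChart.left_inv hx]
  exact hx'

/-- The local trivialization of the normal bundle given by the sections `∂/∂y` of an adapted
chart. -/
def pretrivialization : Pretrivialization Q (π Q F.NormalSpace) where
  toFun v := (v.proj, φ.dy v.proj v.2)
  invFun w := ⟨w.1, φ.frame w.1 w.2⟩
  source := π Q F.NormalSpace ⁻¹' φ.toChart.source
  target := φ.toChart.source ×ˢ univ
  baseSet := φ.toChart.source
  open_target := φ.toChart.open_source.prod isOpen_univ
  open_baseSet := φ.toChart.open_source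
  source_eq := rfl
  target_eq := rfl
  proj_toFun _ _ := rfl
  map_source' v hv := ⟨hv, trivial⟩
  map_target' w hw := hw.1
  left_inv' v hv := by
    obtain ⟨x, v⟩ := v
    simp only
    rw [φ.frame_dy hv]
  right_inv' w hw := by
    simp only
    rw [φ.dy_frame hw.1]

lemma coordChange_eq (φ ψ : F.AdaptedChart) (x : M)
    (hx : x ∈ φ.pretrivialization.baseSet ∩ ψ.pretrivialization.baseSet) (a : Q) :
    coordChange φ ψ x a = (ψ.pretrivialization ⟨x, φ.pretrivialization.symm x a⟩).2 := by
  have h : φ.pretrivialization.symm x a = φ.frame x a := by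
    rw [φ.pretrivialization.symm_apply hx.1]
    rfl
  rw [h]
  exact (dy_frame_transition φ ψ hx.1 hx.2 a).symm

end AdaptedChart

/-- The normal bundle of a foliation, as a vector bundle with the local trivializations given by the
adapted charts. -/
def normalPrebundle : VectorPrebundle ℝ Q F.NormalSpace where
  pretrivializationAtlas := range fun φ : F.AdaptedChart => φ.pretrivialization
  pretrivialization_linear' := by
    rintro _ ⟨φ, rfl⟩
    exact ⟨fun b _ => ⟨(φ.dy b).map_add, (φ.dy b).map_smul⟩⟩
  pretrivializationAt x := (F.chartAround x).pretrivialization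
  mem_base_pretrivializationAt := F.mem_chartAround
  pretrivialization_mem_atlas x := ⟨_, rfl⟩
  exists_coordChange := by
    rintro _ ⟨φ, rfl⟩ _ ⟨ψ, rfl⟩
    exact ⟨_, (AdaptedChart.contMDiffOn_coordChange φ ψ).continuousOn,
      AdaptedChart.coordChange_eq φ ψ⟩
  totalSpaceMk_isInducing b := by
    have hb := F.mem_chartAround b
    set φ := F.chartAround b
    let e : F.NormalSpace b ≃ₜ Q :=
      { toFun := φ.dy b
        invFun := φ.frame b
        left_inv := φ.frame_dy hb
        right_inv := φ.dy_frame hb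
        continuous_toFun := (φ.dy b).continuous
        continuous_invFun := (φ.frame b).continuous }
    exact (isInducing_const_prod.2 e.isInducing :
      IsInducing fun v : F.NormalSpace b => (b, φ.dy b v))

instance : F.normalPrebundle.IsContMDiff I ∞ where
  exists_contMDiffCoordChange := by
    rintro _ ⟨φ, rfl⟩ _ ⟨ψ, rfl⟩
    exact ⟨_, AdaptedChart.contMDiffOn_coordChange φ ψ, AdaptedChart.coordChange_eq φ ψ⟩

instance : TopologicalSpace (TotalSpace Q F.NormalSpace) := F.normalPrebundle.totalSpaceTopology

instance : FiberBundle Q F.NormalSpace := F.normalPrebundle.toFiberBundle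

instance : VectorBundle ℝ Q F.NormalSpace := F.normalPrebundle.toVectorBundle

instance : ContMDiffVectorBundle ∞ Q F.NormalSpace I := F.normalPrebundle.contMDiffVectorBundle I

/-- The total space of the normal bundle, a manifold. -/
abbrev NormalBundle : Type _ := TotalSpace Q F.NormalSpace

namespace AdaptedChart

variable {F} (φ : F.AdaptedChart)

/-- The local trivialization of the normal bundle given by the sections `∂/∂y` of an adapted
chart. -/
def trivialization : Trivialization Q (π Q F.NormalSpace) :=
  F.normalPrebundle.trivializationOfMemPretrivializationAtlas ⟨φ, rfl⟩

instance : MemTrivializationAtlas φ.trivialization := ⟨⟨_, ⟨φ, rfl⟩, rfl⟩⟩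

/-- The chart `(x, y, dy)` of the normal bundle induced by an adapted chart `(x, y)`. -/
def normalChart : OpenPartialHomeomorph F.NormalBundle (P × (Q × Q)) :=
  (φ.trivialization.toOpenPartialHomeomorph.trans
    (φ.toChart.prod (OpenPartialHomeomorph.refl Q))).trans
    (Homeomorph.prodAssoc P Q Q).toOpenPartialHomeomorph

@[simp] lemma normalChart_apply (v : F.NormalBundle) :
    φ.normalChart v =
      ((φ.toChart v.proj).1, (φ.toChart v.proj).2, φ.dy v.proj v.2) := rfl

@[simp] lemma mem_normalChart_source (v : F.NormalBundle) :
    v ∈ φ.normalChart.source ↔ v.proj ∈ φ.toChart.source := by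
  have h : v ∈ φ.trivialization.source ↔ v.proj ∈ φ.toChart.source := φ.trivialization.mem_source
  have h' : (φ.trivialization v).1 = v.proj := rfl
  simp [normalChart, h, h']

lemma contMDiffOn_normalChart : ContMDiffOn (I.prod 𝓘(ℝ, Q)) 𝓘(ℝ, P × (Q × Q)) ∞
    φ.normalChart φ.normalChart.source := by
  have h0 : ContMDiffOn (I.prod 𝓘(ℝ, Q)) (I.prod 𝓘(ℝ, Q)) ∞ φ.trivialization
      φ.normalChart.source := φ.trivialization.contMDiffOn.mono fun v hv =>
    φ.trivialization.mem_source.2 ((φ.mem_normalChart_source v).1 hv)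
  have h1 : ContMDiffOn (I.prod 𝓘(ℝ, Q)) I ∞ (fun v : F.NormalBundle => v.proj)
      φ.normalChart.source := contMDiffOn_proj _
  have h2 : ContMDiffOn (I.prod 𝓘(ℝ, Q)) 𝓘(ℝ, P × Q) ∞
      (fun v : F.NormalBundle => φ.toChart v.proj) φ.normalChart.source :=
    φ.isAdapted.contMDiffOn.comp h1 fun v hv => (φ.mem_normalChart_source v).1 hv
  have h3 : ContMDiffOn (I.prod 𝓘(ℝ, Q)) 𝓘(ℝ, Q) ∞
      (fun v : F.NormalBundle => φ.dy v.proj v.2) φ.normalChart.source :=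
    contMDiff_snd.comp_contMDiffOn h0
  have h4 : ContMDiffOn (I.prod 𝓘(ℝ, Q)) 𝓘(ℝ, P) ∞
      (fun v : F.NormalBundle => (φ.toChart v.proj).1) φ.normalChart.source :=
    contDiff_fst.contMDiff.comp_contMDiffOn h2
  have h5 : ContMDiffOn (I.prod 𝓘(ℝ, Q)) 𝓘(ℝ, Q) ∞
      (fun v : F.NormalBundle => (φ.toChart v.proj).2) φ.normalChart.source :=
    contDiff_snd.contMDiff.comp_contMDiffOn h2
  exact h4.prodMk_space (h5.prodMk_space h3)

lemma contMDiffOn_normalChart_symm : ContMDiffOn 𝓘(ℝ, P × (Q × Q)) (I.prod 𝓘(ℝ, Q)) ∞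
    φ.normalChart.symm φ.normalChart.target := by
  have ht : ∀ z ∈ φ.normalChart.target, (z.1, z.2.1) ∈ φ.toChart.target := by
    intro z hz
    have h := φ.toChart.map_source
      ((φ.mem_normalChart_source _).1 (φ.normalChart.map_target hz))
    have h' := φ.normalChart.right_inv hz
    rw [normalChart_apply] at h'
    rw [← h']
    exact h
  have h1 : ContMDiffOn 𝓘(ℝ, P × (Q × Q)) I ∞
      (fun z : P × (Q × Q) => φ.toChart.symm (z.1, z.2.1)) φ.normalChart.target :=
    φ.isAdapted.contMDiffOn_symm.comp
      (contDiff_fst.prodMk (contDiff_fst.comp contDiff_snd)).contMDiff.contMDiffOn ht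
  have h2 : ContMDiffOn 𝓘(ℝ, P × (Q × Q)) 𝓘(ℝ, Q) ∞
      (fun z : P × (Q × Q) => z.2.2) φ.normalChart.target :=
    (contDiff_snd.comp contDiff_snd).contMDiff.contMDiffOn
  exact φ.trivialization.contMDiffOn_symm.comp (h1.prodMk h2) fun z hz =>
    φ.trivialization.mem_target.2 (φ.toChart.map_target (ht z hz))

/-- The transverse coordinates `(y, dy)` on the normal bundle. -/
def normalTransverse (v : F.NormalBundle) : Q × Q := (φ.toChart v.proj |>.2, φ.dy v.proj v.2)

/-- The kernel of the differential at `v` of the transverse coordinates `(y, dy)`. -/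
def normalKer (v : F.NormalBundle) : Submodule ℝ (TangentSpace (I.prod 𝓘(ℝ, Q)) v) :=
  ((ContinuousLinearMap.snd ℝ P (Q × Q)).comp
    (mfderiv (I.prod 𝓘(ℝ, Q)) 𝓘(ℝ, P × (Q × Q)) φ.normalChart v :
      TangentSpace (I.prod 𝓘(ℝ, Q)) v →L[ℝ] P × (Q × Q))).ker

lemma mem_normalKer {v : F.NormalBundle} (ξ : TangentSpace (I.prod 𝓘(ℝ, Q)) v) :
    ξ ∈ φ.normalKer v ↔
      (mfderiv (I.prod 𝓘(ℝ, Q)) 𝓘(ℝ, P × (Q × Q)) φ.normalChart v ξ : P × (Q × Q)).2 = 0 :=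
  Iff.rfl

lemma hasMFDerivAt_normalTransverse {v : F.NormalBundle} (hv : v.proj ∈ φ.toChart.source) :
    HasMFDerivAt (I.prod 𝓘(ℝ, Q)) 𝓘(ℝ, Q × Q) φ.normalTransverse v
      ((ContinuousLinearMap.snd ℝ P (Q × Q)).comp
        (mfderiv (I.prod 𝓘(ℝ, Q)) 𝓘(ℝ, P × (Q × Q)) φ.normalChart v :
          TangentSpace (I.prod 𝓘(ℝ, Q)) v →L[ℝ] P × (Q × Q))) := by
  have h : MDifferentiableAt (I.prod 𝓘(ℝ, Q)) 𝓘(ℝ, P × (Q × Q)) φ.normalChart v :=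
    (φ.contMDiffOn_normalChart.contMDiffAt (φ.normalChart.open_source.mem_nhds
      ((φ.mem_normalChart_source v).2 hv))).mdifferentiableAt (by simp)
  exact (hasFDerivAt_snd.hasMFDerivAt (x := φ.normalChart v)).comp v h.hasMFDerivAt

lemma fderiv_transition_inl (φ ψ : F.AdaptedChart) {z : P × Q}
    (hz : z ∈ φ.toChart.target ∩ φ.toChart.symm ⁻¹' ψ.toChart.source) (p : P) :
    fderiv ℝ (transition φ ψ) z (p, 0) = 0 := by
  have hx := φ.toChart.map_target hz.1
  have hzx : φ.toChart (φ.toChart.symm z) = z := φ.toChart.right_inv hz.1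
  have h := fderiv_transition φ ψ hx hz.2 (p, 0)
  rw [hzx] at h
  rw [h]
  refine (ψ.isAdapted.mem_iff _ hz.2 _).1 ((φ.isAdapted.mem_iff _ hx _).2 ?_)
  have h' := φ.mfderiv_mfderiv_symm hx (p, 0)
  rw [hzx] at h'
  exact congrArg Prod.snd h'

/-- The change of transverse coordinates depends locally only on the transverse coordinates. -/
lemma eventually_transition_eq (φ ψ : F.AdaptedChart) {z : P × Q}
    (hz : z ∈ φ.toChart.target ∩ φ.toChart.symm ⁻¹' ψ.toChart.source) :
    ∀ᶠ w in 𝓝 z, transition φ ψ w = transition φ ψ (z.1, w.2) := by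
  obtain ⟨r, hr, hball⟩ := Metric.isOpen_iff.1 (isOpen_transition φ ψ) z hz
  filter_upwards [Metric.ball_mem_nhds z hr] with w hw
  have hd := (contDiffOn_transition φ ψ).differentiableOn (by simp)
  have hmaps : ∀ p ∈ Metric.ball z.1 r, (p, w.2) ∈ Metric.ball z r := by
    intro p hp
    rw [Metric.mem_ball, Prod.dist_eq, max_lt_iff] at hw ⊢
    exact ⟨hp, hw.2⟩
  have hD : ∀ p ∈ Metric.ball z.1 r,
      HasFDerivAt (fun p => transition φ ψ (p, w.2)) (0 : P →L[ℝ] Q) p := by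
    intro p hp
    have hpz := hball (hmaps p hp)
    have h1 := (hd.differentiableAt ((isOpen_transition φ ψ).mem_nhds hpz)).hasFDerivAt
    have h2 := HasFDerivAt.comp (f := fun p : P => (p, w.2)) (g := transition φ ψ) p h1
      (hasFDerivAt_prodMk_left p w.2)
    convert! h2 using 1
    ext p'
    exact (fderiv_transition_inl φ ψ hpz p').symm
  have hw1 : w.1 ∈ Metric.ball z.1 r := by
    rw [Metric.mem_ball, Prod.dist_eq, max_lt_iff] at hw
    exact hw.1
  exact (convex_ball z.1 r).is_const_of_fderivWithin_eq_zero (𝕜 := ℝ)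
    (fun p hp => (hD p hp).differentiableAt.differentiableWithinAt)
    (fun p hp => (hD p hp).hasFDerivWithinAt.fderivWithin (Metric.isOpen_ball.uniqueDiffWithinAt hp))
    hw1 (Metric.mem_ball_self hr)

lemma normalKer_le (φ ψ : F.AdaptedChart) {v : F.NormalBundle} (hv : v.proj ∈ φ.toChart.source)
    (hv' : v.proj ∈ ψ.toChart.source) : φ.normalKer v ≤ ψ.normalKer v := by
  set z := φ.toChart v.proj with hz_def
  have hz : z ∈ φ.toChart.target ∩ φ.toChart.symm ⁻¹' ψ.toChart.source := by
    refine ⟨φ.toChart.map_source hv, ?_⟩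
    rw [mem_preimage, hz_def, φ.toChart.left_inv hv]
    exact hv'
  have hk : ContDiffAt ℝ ∞ (transition φ ψ) z :=
    (contDiffOn_transition φ ψ).contDiffAt ((isOpen_transition φ ψ).mem_nhds hz)
  set k₀ : Q → Q := fun y => transition φ ψ (z.1, y) with hk₀_def
  have hk₀ : ContDiffAt ℝ ∞ k₀ z.2 :=
    ContDiffAt.comp (f := fun y : Q => (z.1, y)) (g := transition φ ψ) z.2 hk
      (contDiffAt_const.prodMk contDiffAt_id)
  have hev : ∀ᶠ w in 𝓝 z, transition φ ψ =ᶠ[𝓝 w] fun w => k₀ w.2 :=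
    (eventually_transition_eq φ ψ hz).eventually_nhds
  have hk₁ : ContDiffAt ℝ 1 k₀ z.2 := hk₀.of_le (by exact_mod_cast le_top)
  have hdiff : ∀ᶠ w : P × Q in 𝓝 z, DifferentiableAt ℝ k₀ w.2 :=
    continuousAt_snd.eventually (hk₁.eventually (by simp)
      |>.mono fun y hy => hy.differentiableAt (by simp))
  have hmem : ∀ᶠ w in 𝓝 z, w ∈ φ.toChart.target ∩ φ.toChart.symm ⁻¹' ψ.toChart.source :=
    (isOpen_transition φ ψ).mem_nhds hz
  have hcont : ContinuousAt (fun w : F.NormalBundle => φ.toChart w.proj) v :=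
    (φ.toChart.continuousAt hv).comp
      (f := fun w : F.NormalBundle => w.proj) (FiberBundle.continuous_proj Q _).continuousAt
  have hsrc : ∀ᶠ w : F.NormalBundle in 𝓝 v, w.proj ∈ φ.toChart.source :=
    (FiberBundle.continuous_proj Q F.NormalSpace).continuousAt.eventually
      (φ.toChart.open_source.mem_nhds hv)
  set G : Q × Q → Q × Q := fun c => (k₀ c.1, fderiv ℝ k₀ c.1 c.2) with hG_def
  have hG : DifferentiableAt ℝ G (φ.normalTransverse v) := by
    have h1 : DifferentiableAt ℝ k₀ z.2 := hk₀.differentiableAt (by simp)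
    have h2 : DifferentiableAt ℝ (fderiv ℝ k₀) z.2 :=
      (hk₀.fderiv_right (m := 1) (by norm_cast)).differentiableAt (by simp)
    have h3 : DifferentiableAt ℝ (fun c : Q × Q => fderiv ℝ k₀ c.1) (φ.normalTransverse v) :=
      DifferentiableAt.comp (f := fun c : Q × Q => c.1) (g := fderiv ℝ k₀)
        (φ.normalTransverse v) h2 differentiableAt_fst
    have h4 : DifferentiableAt ℝ (fun c : Q × Q => k₀ c.1) (φ.normalTransverse v) :=
      DifferentiableAt.comp (f := fun c : Q × Q => c.1) (g := k₀)
        (φ.normalTransverse v) h1 differentiableAt_fst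
    exact h4.prodMk (h3.clm_apply differentiableAt_snd)
  have hEq : ψ.normalTransverse =ᶠ[𝓝 v] G ∘ φ.normalTransverse := by
    filter_upwards [hsrc, hcont.eventually hev, hcont.eventually hdiff, hcont.eventually hmem]
      with w hw hw1 hw2 hw3
    have hw' : w.proj ∈ ψ.toChart.source := by
      have := hw3.2
      rwa [mem_preimage, φ.toChart.left_inv hw] at this
    refine Prod.ext ?_ ?_
    · have h := hw1.eq_of_nhds
      rw [transition, φ.toChart.left_inv hw] at h
      exact h
    · have h1 : ψ.dy w.proj w.2 = ψ.dy w.proj (φ.frame w.proj (φ.dy w.proj w.2)) := by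
        rw [φ.frame_dy hw]
      have h2 : HasFDerivAt (fun w : P × Q => k₀ w.2)
          ((fderiv ℝ k₀ (φ.toChart w.proj).2).comp (ContinuousLinearMap.snd ℝ P Q))
          (φ.toChart w.proj) := hw2.hasFDerivAt.comp _ hasFDerivAt_snd
      change ψ.dy w.proj w.2 = fderiv ℝ k₀ (φ.toChart w.proj).2 (φ.dy w.proj w.2)
      rw [h1, dy_frame_transition φ ψ hw hw', hw1.fderiv_eq, h2.fderiv]
      rfl
  have h1 := φ.hasMFDerivAt_normalTransverse hv
  have h2 := (hG.hasFDerivAt.hasMFDerivAt.comp v h1).congr_of_eventuallyEq hEq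
  have h3 := hasMFDerivAt_unique (ψ.hasMFDerivAt_normalTransverse hv') h2
  intro ξ hξ
  have h4 := DFunLike.congr_fun h3 ξ
  refine (ψ.mem_normalKer ξ).2 (h4.trans ?_)
  have h5 := (φ.mem_normalKer ξ).1 hξ
  exact (congrArg (fderiv ℝ G (φ.normalTransverse v)) h5).trans (map_zero _)

end AdaptedChart

lemma isAdaptedChart_normalChart (φ : F.AdaptedChart) : IsAdaptedChart (I.prod 𝓘(ℝ, Q))
    (fun v : F.NormalBundle => (F.chartAround v.proj).normalKer v) φ.normalChart where
  contMDiffOn := φ.contMDiffOn_normalChart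
  contMDiffOn_symm := φ.contMDiffOn_normalChart_symm
  mem_iff v hv ξ := by
    have h := (φ.mem_normalChart_source v).1 hv
    rw [← φ.mem_normalKer ξ]
    exact ⟨fun h' => AdaptedChart.normalKer_le _ φ (F.mem_chartAround _) h h',
      fun h' => AdaptedChart.normalKer_le φ _ h (F.mem_chartAround _) h'⟩

/-- The foliation of the normal bundle induced by `F`: in the charts `(x, y, dy)` induced by
adapted charts `(x, y)` of `M`, its transverse coordinates are `(y, dy)`. -/
def normalFoliation : Foliation (I.prod 𝓘(ℝ, Q)) F.NormalBundle P (Q × Q) where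
  tangent v := (F.chartAround v.proj).normalKer v
  exists_chart v := by
    refine ⟨(F.chartAround v.proj).normalChart,
      (AdaptedChart.mem_normalChart_source _ v).2 (F.mem_chartAround v.proj), ?_⟩
    exact F.isAdaptedChart_normalChart _

/-- The chart `(x, y, dy)` of the normal bundle, as a chart adapted to `F.normalFoliation`. -/
def AdaptedChart.normalAdapted {F : Foliation I M P Q} (φ : F.AdaptedChart) :
    F.normalFoliation.AdaptedChart where
  toChart := φ.normalChart
  isAdapted := F.isAdaptedChart_normalChart φ

/-! ### Foliated metrics -/

/-- Tensor fields of type `(0, 2)` on the normal bundle. -/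
abbrev NormalForm := ∀ x : M, LinearMap.BilinForm ℝ (F.NormalSpace x)

variable {F} in
/-- The components `g(∂/∂yᵃ, ∂/∂yᵇ)` of a normal tensor field, as functions of the coordinates
`z = (x, y)` of an adapted chart; here `a` and `b` are arbitrary vectors of the transverse model
space. -/
def AdaptedChart.component (φ : F.AdaptedChart) (g : F.NormalForm) (z : P × Q) (a b : Q) : ℝ :=
  g (φ.toChart.symm z) (φ.frame (φ.toChart.symm z) a) (φ.frame (φ.toChart.symm z) b)

/-- A foliated metric: a smooth Riemannian metric on the normal bundle whose components in adapted
charts `(x, y)` depend (locally) only on the transverse coordinates `y`. -/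
structure IsFoliatedMetric (g : F.NormalForm) : Prop where
  symm : ∀ x v w, g x v w = g x w v
  pos : ∀ x v, v ≠ 0 → 0 < g x v v
  smooth : ∀ (φ : F.AdaptedChart) (a b : Q),
    ContDiffOn ℝ ∞ (fun z => φ.component g z a b) φ.toChart.target
  basic : ∀ (φ : F.AdaptedChart) (a b : Q), ∀ z ∈ φ.toChart.target,
    ∀ᶠ w in 𝓝 z, w.2 = z.2 → φ.component g w a b = φ.component g z a b

/-! ### Transversely affine foliations and foliated Hessian metrics -/

variable {F} in
/-- An adapted chart is affine for the connection `D` of the normal bundle if the sections `∂/∂y` of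
the normal bundle are `D`-parallel on its domain. -/
def AdaptedChart.IsAffine (φ : F.AdaptedChart) (D : CovariantDerivative I Q F.NormalSpace) : Prop :=
  ∀ x ∈ φ.toChart.source, ∀ a : Q, D (fun x' => φ.frame x' a) x = 0

/-- `D` is a foliated flat (torsion-free) connection of the normal bundle: locally it is the pull
back, by submersions `y` defining the foliation, of the standard flat connection of the affine
space `Q`. -/
def IsFoliatedFlat (D : CovariantDerivative I Q F.NormalSpace) : Prop :=
  ∀ x : M, ∃ φ : F.AdaptedChart, x ∈ φ.toChart.source ∧ φ.IsAffine D

/-- A foliated Hessian metric on `(M, F, D)`: a foliated metric which, in affine adapted charts, is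
locally of the form `g_ij = ∂²h / ∂yⁱ∂yʲ` with a smooth function `h` of the transverse
coordinates. -/
def IsFoliatedHessian (D : CovariantDerivative I Q F.NormalSpace) (g : F.NormalForm) : Prop :=
  F.IsFoliatedMetric g ∧
    ∀ x : M, ∃ φ : F.AdaptedChart, x ∈ φ.toChart.source ∧ φ.IsAffine D ∧
      ∃ h : Q → ℝ, ContDiffOn ℝ ∞ h (Prod.snd '' φ.toChart.target) ∧
        ∀ z ∈ φ.toChart.target, ∀ a b : Q,
          φ.component g z a b = fderiv ℝ (fderiv ℝ h) z.2 a b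

/-! ### Transversely holomorphic foliations and foliated Kähler metrics -/

section Kahler

variable (F' : Foliation I M P (Q × Q))

/-- Multiplication by `√-1` on the complexification `Q × Q` of `Q`, where `(a, b)` is `a + √-1 b`. -/
def mulI (Q : Type*) [NormedAddCommGroup Q] [NormedSpace ℝ Q] : Q × Q →L[ℝ] Q × Q :=
  (-ContinuousLinearMap.snd ℝ Q Q).prod (ContinuousLinearMap.fst ℝ Q Q)

/-- Fields of endomorphisms of the normal bundle. -/
abbrev NormalEnd := ∀ x : M, F.NormalSpace x →ₗ[ℝ] F.NormalSpace x

variable {F'} in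
/-- The transverse coordinates of the adapted chart are holomorphic for `J`. -/
def AdaptedChart.IsHolomorphic (φ : F'.AdaptedChart) (J : F'.NormalEnd) : Prop :=
  ∀ x ∈ φ.toChart.source, ∀ c : Q × Q, J x (φ.frame x c) = φ.frame x (mulI Q c)

/-- A foliated (integrable) complex structure: the foliation is transversely holomorphic, and `J` is
its complex structure on the normal bundle. -/
def IsFoliatedComplex (J : F'.NormalEnd) : Prop :=
  ∀ x : M, ∃ φ : F'.AdaptedChart, x ∈ φ.toChart.source ∧ φ.IsHolomorphic J

/-- The fundamental form `ω(v, w) = g(J v, w)`. -/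
def fundamentalForm (J : F.NormalEnd) (g : F.NormalForm) : F.NormalForm :=
  fun x => (g x) ∘ₗ (J x)

/-- The transverse exterior derivative of the (basic) 2-form `σ` vanishes: in every adapted chart
`(x, y)`, `∂_a σ(∂_b, ∂_c) + ∂_b σ(∂_c, ∂_a) + ∂_c σ(∂_a, ∂_b) = 0` for all constant transverse
directions `a, b, c`. -/
def IsTransverselyClosed (σ : F.NormalForm) : Prop :=
  ∀ φ : F.AdaptedChart, ∀ z ∈ φ.toChart.target, ∀ a b c : Q,
    fderiv ℝ (fun w => φ.component σ w b c) z (0, a) +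
      fderiv ℝ (fun w => φ.component σ w c a) z (0, b) +
      fderiv ℝ (fun w => φ.component σ w a b) z (0, c) = 0

/-- `g` is a foliated Kähler metric on `(M, F', J)`: `J` is a foliated complex structure, `g` is a
foliated metric which is Hermitian for `J`, and its fundamental form is closed. -/
structure IsFoliatedKahler (J : F'.NormalEnd) (g : F'.NormalForm) : Prop where
  complex : F'.IsFoliatedComplex J
  metric : F'.IsFoliatedMetric g
  hermitian : ∀ x v w, g x (J x v) (J x w) = g x v w
  closed : F'.IsTransverselyClosed (F'.fundamentalForm J g)

end Kahler

/-! ### The structures on the normal bundle of a transversely affine foliation -/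

section NormalLift

variable {F} {D : CovariantDerivative I Q F.NormalSpace}

/-- An affine adapted chart around a point. -/
def affineChart (hD : F.IsFoliatedFlat D) (x : M) : F.AdaptedChart := (hD x).choose

/-- The complex structure `J_N` on the normal bundle of `F.normalFoliation`: multiplication by `√-1`
in the transverse coordinates `zⁱ = yⁱ + √-1 dyⁱ` induced by affine adapted charts. (Changes of
affine adapted charts act on `z` by locally constant real affine maps, so the choice of the chart is
irrelevant.) -/
def normalJ (hD : F.IsFoliatedFlat D) : F.normalFoliation.NormalEnd := fun v =>
  let Φ := (affineChart hD v.proj).normalAdapted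
  ((Φ.frame v).comp ((mulI Q).comp (Φ.dy v))).toLinearMap

/-- The lifted metric `g^N = ∑ g_ij dzⁱ dz̄ʲ = ∑ g_ij (dyⁱ dyʲ + d(dyⁱ) d(dyʲ))` on the normal bundle
of `F.normalFoliation`, with `zⁱ = yⁱ + √-1 dyⁱ` induced by affine adapted charts and `g_ij` taken
at the base point. -/
def liftedMetric (hD : F.IsFoliatedFlat D) (g : F.NormalForm) : F.normalFoliation.NormalForm :=
  fun v =>
    let φ := affineChart hD v.proj
    let Re := ((φ.frame v.proj).comp
      ((ContinuousLinearMap.fst ℝ Q Q).comp (φ.normalAdapted.dy v))).toLinearMap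
    let Im := ((φ.frame v.proj).comp
      ((ContinuousLinearMap.snd ℝ Q Q).comp (φ.normalAdapted.dy v))).toLinearMap
    (g v.proj).compl₁₂ Re Re + (g v.proj).compl₁₂ Im Im

end NormalLift

end Foliation
end Foliations
end

noncomputable section

namespace Foliation

/-! In the chart `(x, y, dy)` induced by an affine chart, the fundamental form of the lifted metric
is `ω = ∑ g_ij dyⁱ ∧ d(dyʲ)` (`component_fundamentalForm`), and `g_ij` depends on `y` alone. Hence
`dω = ∑ ∂_k g_ij dyᵏ ∧ dyⁱ ∧ d(dyʲ)`, which vanishes exactly when `∂_k g_ij` is symmetric in `k, i`,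
hence totally symmetric because `g` is. A Hessian has this property because third derivatives
commute (`fderiv_hessian_swap`). Conversely, two applications of the Poincaré lemma on a ball
produce a potential `h` (`exists_hessian_eq`).

The other Kähler conditions hold for every foliated metric. What makes them meaningful is that
affine charts differ, transversally, by maps with locally constant Jacobian `A`
(`IsAffine.fderiv_jacobian`): comparing parallel frames through the Leibniz rule kills `dA`. The
induced change of `(y, dy)` then has differential `A ⊕ A`, which commutes with multiplication by
`√-1`, so the complex structure and the lifted metric, defined pointwise through chosen affine
charts, have the expected expression in all of them.

The definitions of foliated metric and of closedness range over all adapted charts, whereas the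
computations are made in the charts induced by affine ones. The passage between the two is the
tensoriality of components and the naturality of the transverse exterior derivative
(`smoothAt_of_overlap`, `basicAt_of_overlap`, `cyclicDeriv_of_overlap`). -/

set_option synthInstance.maxHeartbeats 200000 in
/-- The derivative of a moving bilinear form evaluated at two moving vectors. -/
lemma _root_.fderiv_bilinear_comp_apply_apply {X Y Q : Type*} [NormedAddCommGroup X]
    [NormedSpace ℝ X] [NormedAddCommGroup Y] [NormedSpace ℝ Y] [NormedAddCommGroup Q]
    [NormedSpace ℝ Q] {S : Y → Q →L[ℝ] Q →L[ℝ] ℝ} {t : X → Y} {u v : X → Q} {u' v' : X →L[ℝ] Q}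
    {z : X} (hS : DifferentiableAt ℝ S (t z)) (ht : DifferentiableAt ℝ t z)
    (hu : HasFDerivAt u u' z) (hv : HasFDerivAt v v' z) (w : X) :
    fderiv ℝ (fun x => S (t x) (u x) (v x)) z w =
      fderiv ℝ S (t z) (fderiv ℝ t z w) (u z) (v z) + S (t z) (u' w) (v z) +
        S (t z) (u z) (v' w) := by
  have hSt : HasFDerivAt (fun x => S (t x)) ((fderiv ℝ S (t z)).comp (fderiv ℝ t z)) z :=
    HasFDerivAt.comp (g := S) (f := t) z hS.hasFDerivAt ht.hasFDerivAt
  rw [((hSt.clm_apply hu).clm_apply hv).fderiv]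
  simp
  ring

/-! ### Change of adapted chart: components, basicness and the transverse exterior derivative. -/

section Transfer

variable {E : Type*} [NormedAddCommGroup E] [NormedSpace ℝ E]
  {H : Type*} [TopologicalSpace H] {I : ModelWithCorners ℝ E H}
  {M : Type*} [TopologicalSpace M] [ChartedSpace H M]
  {P : Type*} [NormedAddCommGroup P] [NormedSpace ℝ P]
  {Q : Type*} [NormedAddCommGroup Q] [NormedSpace ℝ Q]
  {F : Foliation I M P Q}

namespace AdaptedChart

/-- The domain, in the coordinates of `φ`, of the change of charts from `φ` to `ψ`. -/
def overlap (φ ψ : F.AdaptedChart) : Set (P × Q) :=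
  φ.toChart.target ∩ φ.toChart.symm ⁻¹' ψ.toChart.source

lemma isOpen_overlap (φ ψ : F.AdaptedChart) : IsOpen (overlap φ ψ) := isOpen_transition φ ψ

/-- The change of charts from `φ` to `ψ`. -/
def change (φ ψ : F.AdaptedChart) (z : P × Q) : P × Q := ψ.toChart (φ.toChart.symm z)

lemma change_snd (φ ψ : F.AdaptedChart) (z : P × Q) : (change φ ψ z).2 = transition φ ψ z := rfl

lemma change_mem_target (φ ψ : F.AdaptedChart) {z : P × Q} (hz : z ∈ overlap φ ψ) :
    change φ ψ z ∈ ψ.toChart.target := ψ.toChart.map_source hz.2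

lemma contDiffOn_change (φ ψ : F.AdaptedChart) : ContDiffOn ℝ ∞ (change φ ψ) (overlap φ ψ) :=
  contMDiffOn_iff_contDiffOn.1 (ψ.isAdapted.contMDiffOn.comp
    (φ.isAdapted.contMDiffOn_symm.mono inter_subset_left) inter_subset_right)

/-- The transverse part of the derivative of the change of transverse coordinates. -/
def jacobian (φ ψ : F.AdaptedChart) (z : P × Q) : Q →L[ℝ] Q :=
  (fderiv ℝ (transition φ ψ) z).comp (ContinuousLinearMap.inr ℝ P Q)

lemma jacobian_apply (φ ψ : F.AdaptedChart) (z : P × Q) (a : Q) :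
    jacobian φ ψ z a = fderiv ℝ (transition φ ψ) z (0, a) := rfl

lemma contDiffOn_jacobian (φ ψ : F.AdaptedChart) :
    ContDiffOn ℝ ∞ (jacobian φ ψ) (overlap φ ψ) :=
  ((contDiffOn_transition φ ψ).fderiv_of_isOpen (isOpen_transition φ ψ) (by simp)).clm_comp
    contDiffOn_const

lemma frame_eq_frame_jacobian (φ ψ : F.AdaptedChart) {z : P × Q} (hz : z ∈ overlap φ ψ) (a : Q) :
    φ.frame (φ.toChart.symm z) a = ψ.frame (φ.toChart.symm z) (jacobian φ ψ z a) := by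
  have h := dy_frame_transition φ ψ (φ.toChart.map_target hz.1) hz.2 a
  rw [φ.toChart.right_inv hz.1] at h
  rw [jacobian_apply, ← h, ψ.frame_dy hz.2]

lemma component_eq (φ ψ : F.AdaptedChart) (σ : F.NormalForm) {z : P × Q} (hz : z ∈ overlap φ ψ)
    (a b : Q) : φ.component σ z a b =
      ψ.component σ (change φ ψ z) (jacobian φ ψ z a) (jacobian φ ψ z b) := by
  have h : ψ.toChart.symm (change φ ψ z) = φ.toChart.symm z := ψ.toChart.left_inv hz.2
  rw [component, component, h, frame_eq_frame_jacobian φ ψ hz, frame_eq_frame_jacobian φ ψ hz]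

/-- A normal tensor field has smooth components in the chart. -/
def HasSmoothComponents (φ : F.AdaptedChart) (σ : F.NormalForm) : Prop :=
  ∀ a b : Q, ContDiffOn ℝ ∞ (fun z => φ.component σ z a b) φ.toChart.target

/-- The components of a normal tensor field in the chart depend locally only on the transverse
coordinates. -/
def HasBasicComponents (φ : F.AdaptedChart) (σ : F.NormalForm) : Prop :=
  ∀ a b : Q, ∀ z ∈ φ.toChart.target,
    ∀ᶠ w in 𝓝 z, w.2 = z.2 → φ.component σ w a b = φ.component σ z a b

/-- The transition is locally a function of the transverse coordinate only, so its derivative cannot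
see a displacement along the leaf. -/
lemma eventually_jacobian_eq (φ ψ : F.AdaptedChart) {z : P × Q} (hz : z ∈ overlap φ ψ) :
    ∀ᶠ w in 𝓝 z, w.2 = z.2 → jacobian φ ψ w = jacobian φ ψ z := by
  have h := (eventually_transition_eq φ ψ hz).eventually_nhds
  have hz' := h.self_of_nhds
  filter_upwards [h] with w hw hwz
  have hw' : transition φ ψ =ᶠ[𝓝 w] fun v => transition φ ψ (z.1, v.2) := hw
  have hz'' : transition φ ψ =ᶠ[𝓝 z] fun v => transition φ ψ (z.1, v.2) := hz'
  rw [jacobian, jacobian, hw'.fderiv_eq, hz''.fderiv_eq]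
  -- The local model with leaf coordinate frozen at `z.1` is invariant under translation by the
  -- leafwise vector `w - z`, so its derivatives at `z` and `w` coincide.
  have hshift : (fun v : P × Q => transition φ ψ (z.1, v.2)) =
      fun v => (fun v : P × Q => transition φ ψ (z.1, v.2)) (v + (w - z)) := by
    ext v
    simp [hwz]
  have hfd := fderiv_comp_add_right (𝕜 := ℝ) (f := fun v : P × Q => transition φ ψ (z.1, v.2))
    (x := z) (w - z)
  rw [add_sub_cancel] at hfd
  rw [← hfd, ← hshift]

/-- The component is constant near `0` along the line `t ↦ z + t (p, 0)`, which fixes the transverse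
coordinate; uniqueness of derivatives gives the claim. -/
lemma HasBasicComponents.fderiv_inl {φ : F.AdaptedChart} {σ : F.NormalForm}
    (hb : φ.HasBasicComponents σ) (hs : φ.HasSmoothComponents σ) {z : P × Q}
    (hz : z ∈ φ.toChart.target) (a b : Q) (p : P) :
    fderiv ℝ (fun w => φ.component σ w a b) z (p, 0) = 0 := by
  have hd : DifferentiableAt ℝ (fun w => φ.component σ w a b) z :=
    ((hs a b).contDiffAt (φ.toChart.open_target.mem_nhds hz)).differentiableAt (by simp)
  have hc : HasDerivAt (fun t : ℝ => z + t • ((p, 0) : P × Q)) (p, 0) 0 := by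
    simpa using ((hasDerivAt_id (0 : ℝ)).smul_const ((p, 0) : P × Q)).const_add z
  have hd' : HasFDerivAt (fun w => φ.component σ w a b)
      (fderiv ℝ (fun w => φ.component σ w a b) z) (z + (0 : ℝ) • ((p, 0) : P × Q)) := by
    simpa using hd.hasFDerivAt
  have h1 := hd'.comp_hasDerivAt (0 : ℝ) hc
  have htend : Tendsto (fun t : ℝ => z + t • ((p, 0) : P × Q)) (𝓝 0) (𝓝 z) := by
    simpa using hc.continuousAt.tendsto
  have h2 : (fun w => φ.component σ w a b) ∘ (fun t : ℝ => z + t • ((p, 0) : P × Q)) =ᶠ[𝓝 0]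
      fun _ => φ.component σ z a b := by
    filter_upwards [htend.eventually (hb a b z hz)] with t ht
    exact ht (by simp)
  exact h1.unique ((hasDerivAt_const _ _).congr_of_eventuallyEq h2)

/-- When `w` moves along the leaf, both the transverse coordinate in `ψ` and the Jacobian stay
fixed, so basicness in `ψ` is only needed for the two fixed vectors `jacobian φ ψ z a` and `jacobian
φ ψ z b`. -/
lemma basicAt_of_overlap (φ ψ : F.AdaptedChart) {σ : F.NormalForm}
    (hb : ψ.HasBasicComponents σ) (a b : Q) {z : P × Q} (hz : z ∈ overlap φ ψ) :
    ∀ᶠ w in 𝓝 z, w.2 = z.2 → φ.component σ w a b = φ.component σ z a b := by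
  have hc : ContinuousAt (change φ ψ) z :=
    (contDiffOn_change φ ψ).continuousOn.continuousAt ((isOpen_overlap φ ψ).mem_nhds hz)
  filter_upwards [eventually_transition_eq φ ψ hz, eventually_jacobian_eq φ ψ hz,
    (isOpen_overlap φ ψ).mem_nhds hz,
    hc.eventually (hb (jacobian φ ψ z a) (jacobian φ ψ z b) _ (change_mem_target φ ψ hz))]
    with w hw1 hw2 hw3 hw4 hwz
  rw [component_eq φ ψ σ hw3, component_eq φ ψ σ hz, hw2 hwz]
  refine hw4 ?_
  rw [change_snd, change_snd, hw1, hwz]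

variable [FiniteDimensional ℝ Q]

/-- The components of a normal tensor field, as a function with values in continuous bilinear
forms. -/
def componentL (φ : F.AdaptedChart) (σ : F.NormalForm) (z : P × Q) : Q →L[ℝ] Q →L[ℝ] ℝ :=
  ((σ (φ.toChart.symm z)).compl₁₂ (φ.frame (φ.toChart.symm z)).toLinearMap
    (φ.frame (φ.toChart.symm z)).toLinearMap).toContinuousBilinearMap

@[simp] lemma componentL_apply (φ : F.AdaptedChart) (σ : F.NormalForm) (z : P × Q) (a b : Q) :
    φ.componentL σ z a b = φ.component σ z a b := rfl

/-- Finite dimension of `Q` upgrades smoothness for each fixed pair of vectors to smoothness of the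
operator-valued map. This is needed because a change of chart makes the vectors move with the point.
-/
lemma HasSmoothComponents.contDiffOn_componentL {φ : F.AdaptedChart} {σ : F.NormalForm}
    (hs : φ.HasSmoothComponents σ) : ContDiffOn ℝ ∞ (φ.componentL σ) φ.toChart.target := by
  rw [contDiffOn_clm_apply]
  intro a
  rw [contDiffOn_clm_apply]
  exact fun b => hs a b

lemma HasSmoothComponents.fderiv_component {φ : F.AdaptedChart} {σ : F.NormalForm}
    (hs : φ.HasSmoothComponents σ) {z : P × Q} (hz : z ∈ φ.toChart.target) (a b : Q)
    (v : P × Q) : fderiv ℝ (fun w => φ.component σ w a b) z v =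
      fderiv ℝ (φ.componentL σ) z v a b := by
  have hd : DifferentiableAt ℝ (φ.componentL σ) z :=
    (hs.contDiffOn_componentL.contDiffAt (φ.toChart.open_target.mem_nhds hz)).differentiableAt
      (by simp)
  have h := (hd.hasFDerivAt.clm_apply (hasFDerivAt_const a z)).clm_apply (hasFDerivAt_const b z)
  rw [HasFDerivAt.fderiv (f := fun w => φ.component σ w a b) h]
  simp

lemma smoothAt_of_overlap (φ ψ : F.AdaptedChart) {σ : F.NormalForm}
    (hs : ψ.HasSmoothComponents σ) (a b : Q) {z : P × Q} (hz : z ∈ overlap φ ψ) :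
    ContDiffAt ℝ ∞ (fun w => φ.component σ w a b) z := by
  have h1 : ContDiffOn ℝ ∞ (fun w => ψ.componentL σ (change φ ψ w)) (overlap φ ψ) :=
    hs.contDiffOn_componentL.comp (contDiffOn_change φ ψ) fun w hw => change_mem_target φ ψ hw
  have h2 := (h1.clm_apply ((contDiffOn_jacobian φ ψ).clm_apply
    (contDiffOn_const (c := a)))).clm_apply
    ((contDiffOn_jacobian φ ψ).clm_apply (contDiffOn_const (c := b)))
  exact (h2.congr fun w hw => component_eq φ ψ σ hw a b).contDiffAt
    ((isOpen_overlap φ ψ).mem_nhds hz)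

/-- The cyclic sum defining the transverse exterior derivative of a normal `2`-form. -/
def cyclicDeriv (φ : F.AdaptedChart) (σ : F.NormalForm) (z : P × Q) (a b c : Q) : ℝ :=
  fderiv ℝ (fun w => φ.component σ w b c) z (0, a) +
    fderiv ℝ (fun w => φ.component σ w c a) z (0, b) +
    fderiv ℝ (fun w => φ.component σ w a b) z (0, c)

-- The Leibniz rule applied to the transformation law of the components: besides the tensorial term
-- there are two terms with the second derivative of the transition, one for each slot.
set_option synthInstance.maxHeartbeats 200000 in
lemma fderiv_component_of_overlap (φ ψ : F.AdaptedChart) {σ : F.NormalForm}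
    (hs : ψ.HasSmoothComponents σ) (hb : ψ.HasBasicComponents σ)
    {z : P × Q} (hz : z ∈ overlap φ ψ) (a b c : Q) :
    fderiv ℝ (fun w => φ.component σ w b c) z (0, a) =
      fderiv ℝ (fun w => ψ.component σ w (jacobian φ ψ z b) (jacobian φ ψ z c)) (change φ ψ z)
        (0, jacobian φ ψ z a) +
      ψ.component σ (change φ ψ z) (fderiv ℝ (fderiv ℝ (transition φ ψ)) z (0, a) (0, b))
        (jacobian φ ψ z c) +
      ψ.component σ (change φ ψ z) (jacobian φ ψ z b)
        (fderiv ℝ (fderiv ℝ (transition φ ψ)) z (0, a) (0, c)) := by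
  have hn := (isOpen_overlap φ ψ).mem_nhds hz
  have ht := change_mem_target φ ψ hz
  have hS : DifferentiableAt ℝ (ψ.componentL σ) (change φ ψ z) :=
    (hs.contDiffOn_componentL.contDiffAt (ψ.toChart.open_target.mem_nhds ht)).differentiableAt
      (by simp)
  have hC : DifferentiableAt ℝ (change φ ψ) z :=
    ((contDiffOn_change φ ψ).contDiffAt hn).differentiableAt (by simp)
  have hT : DifferentiableAt ℝ (fderiv ℝ (transition φ ψ)) z :=
    (((contDiffOn_transition φ ψ).fderiv_of_isOpen (m := ∞) (isOpen_transition φ ψ)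
      (by simp)).contDiffAt hn).differentiableAt (by simp)
  have hJ : ∀ b : Q, HasFDerivAt (fun w => jacobian φ ψ w b)
      ((fderiv ℝ (fderiv ℝ (transition φ ψ)) z).flip (0, b)) z := fun b => by
    have h := hT.hasFDerivAt.clm_apply (hasFDerivAt_const ((0, b) : P × Q) z)
    refine h.congr_fderiv ?_
    ext v <;> simp
  have hE : (fun w => φ.component σ w b c) =ᶠ[𝓝 z] fun w =>
      ψ.componentL σ (change φ ψ w) (jacobian φ ψ w b) (jacobian φ ψ w c) := by
    filter_upwards [hn] with w hw
    exact component_eq φ ψ σ hw b c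
  have hsnd : (fderiv ℝ (change φ ψ) z (0, a)).2 = jacobian φ ψ z a := by
    rw [jacobian_apply]
    have : HasFDerivAt (transition φ ψ)
      ((ContinuousLinearMap.snd ℝ P Q).comp (fderiv ℝ (change φ ψ) z)) z := hC.hasFDerivAt.snd
    rw [this.fderiv]
    rfl
  -- A transverse vector of `φ` may acquire a leaf component in `ψ`; basicness makes the derivative
  -- in that direction vanish, leaving the transverse part.
  have hsplit : fderiv ℝ (change φ ψ) z (0, a) =
      ((fderiv ℝ (change φ ψ) z (0, a)).1, 0) + (0, jacobian φ ψ z a) := by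
    rw [← hsnd]
    simp
  rw [hE.fderiv_eq, fderiv_bilinear_comp_apply_apply hS hC (hJ b) (hJ c)]
  have hzero := hb.fderiv_inl hs ht (jacobian φ ψ z b) (jacobian φ ψ z c)
    (fderiv ℝ (change φ ψ) z (0, a)).1
  have hsum : fderiv ℝ (ψ.componentL σ) (change φ ψ z) (fderiv ℝ (change φ ψ) z (0, a))
      (jacobian φ ψ z b) (jacobian φ ψ z c) =
      fderiv ℝ (fun w => ψ.component σ w (jacobian φ ψ z b) (jacobian φ ψ z c)) (change φ ψ z)
        (0, jacobian φ ψ z a) := by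
    rw [hs.fderiv_component ht] at hzero ⊢
    rw [hsplit, map_add]
    simp [hzero]
  rw [← hsum]
  rfl

/-- The six terms containing second derivatives of the transition cancel in pairs, by symmetry of
the second derivative and antisymmetry of `σ`. This is the usual naturality of the exterior
derivative. -/
lemma cyclicDeriv_of_overlap (φ ψ : F.AdaptedChart) {σ : F.NormalForm}
    (hs : ψ.HasSmoothComponents σ) (hb : ψ.HasBasicComponents σ)
    (halt : ∀ z ∈ ψ.toChart.target, ∀ a b, ψ.component σ z a b = -ψ.component σ z b a)
    {z : P × Q} (hz : z ∈ overlap φ ψ) (a b c : Q) :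
    φ.cyclicDeriv σ z a b c =
      ψ.cyclicDeriv σ (change φ ψ z) (jacobian φ ψ z a) (jacobian φ ψ z b)
        (jacobian φ ψ z c) := by
  have hsymm : IsSymmSndFDerivAt ℝ (transition φ ψ) z :=
    ((contDiffOn_transition φ ψ).contDiffAt ((isOpen_transition φ ψ).mem_nhds hz)).isSymmSndFDerivAt
      (by
        rw [minSmoothness_of_isRCLikeNormedField]
        exact WithTop.coe_le_coe.2 (le_top (a := (2 : ℕ∞))))
  have ht := change_mem_target φ ψ hz
  rw [cyclicDeriv, cyclicDeriv, fderiv_component_of_overlap φ ψ hs hb hz,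
    fderiv_component_of_overlap φ ψ hs hb hz, fderiv_component_of_overlap φ ψ hs hb hz,
    hsymm (0, b) (0, a), hsymm (0, c) (0, b), hsymm (0, c) (0, a)]
  rw [halt _ ht (jacobian φ ψ z b), halt _ ht (jacobian φ ψ z c), halt _ ht (jacobian φ ψ z a)]
  ring

end AdaptedChart

end Transfer

end Foliation

namespace Foliation

/-! ### Parallel frames and locally constant Jacobians. -/

section Affine

variable {E : Type*} [NormedAddCommGroup E] [NormedSpace ℝ E]
  {H : Type*} [TopologicalSpace H] {I : ModelWithCorners ℝ E H}
  {M : Type*} [TopologicalSpace M] [ChartedSpace H M]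
  {P : Type*} [NormedAddCommGroup P] [NormedSpace ℝ P]
  {Q : Type*} [NormedAddCommGroup Q] [NormedSpace ℝ Q]
  {F : Foliation I M P Q} {D : CovariantDerivative I Q F.NormalSpace}

/-- A covariant derivative of a finite combination of sections with variable coefficients. -/
lemma covariantDerivative_sum_smul {ι : Type*} (s : Finset ι) {c : ι → M → ℝ}
    {σ : ι → ∀ x : M, F.NormalSpace x} {x : M}
    (hc : ∀ i, MDifferentiableAt I 𝓘(ℝ) (c i) x)
    (hσ : ∀ i, MDifferentiableAt I (I.prod 𝓘(ℝ, Q)) (fun y => TotalSpace.mk' Q y (σ i y)) x) :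
    MDifferentiableAt I (I.prod 𝓘(ℝ, Q))
        (fun y => TotalSpace.mk' Q y ((∑ i ∈ s, c i • σ i) y)) x ∧
      D (∑ i ∈ s, c i • σ i) x =
        ∑ i ∈ s, (c i x • D (σ i) x + (mvfderiv I (c i) x).smulRight (σ i x)) := by
  classical
  have hm : ∀ i, MDifferentiableAt I (I.prod 𝓘(ℝ, Q))
      (fun y => TotalSpace.mk' Q y ((c i • σ i) y)) x := fun i => (hc i).smul_section (hσ i)
  induction s using Finset.induction_on with
  | empty =>
    refine ⟨?_, by simp⟩
    simpa using! mdifferentiableAt_zeroSection (𝕜 := ℝ) (IB := I) (F := Q) (E := F.NormalSpace)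
  | insert i s hi ih =>
    simp only [Finset.sum_insert hi]
    refine ⟨mdifferentiableAt_add_section (hm i) ih.1, ?_⟩
    rw [D.isCovariantDerivativeOnUniv.add (hm i) ih.1,
      D.isCovariantDerivativeOnUniv.leibniz (hσ i) (hc i), ih.2]

namespace AdaptedChart

lemma mdifferentiableAt_frame (φ : F.AdaptedChart) {x : M} (hx : x ∈ φ.toChart.source) (a : Q) :
    MDifferentiableAt I (I.prod 𝓘(ℝ, Q)) (fun y => TotalSpace.mk' Q y (φ.frame y a)) x := by
  have h : ContMDiffOn I (I.prod 𝓘(ℝ, Q)) ∞ (fun y => TotalSpace.mk' Q y (φ.frame y a))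
      φ.toChart.source :=
    φ.trivialization.contMDiffOn_symm.comp
      (contMDiffOn_id.prodMk contMDiffOn_const) fun y hy => φ.trivialization.mem_target.2 hy
  exact (h.contMDiffAt (φ.toChart.open_source.mem_nhds hx)).mdifferentiableAt (by simp)

lemma frame_eq_frame_coordChange (φ ψ : F.AdaptedChart) {x : M} (hx : x ∈ φ.toChart.source)
    (hx' : x ∈ ψ.toChart.source) (a : Q) : φ.frame x a = ψ.frame x (coordChange φ ψ x a) := by
  have h := dy_frame_transition φ ψ hx hx' a
  change φ.frame x a = ψ.frame x (fderiv ℝ (transition φ ψ) (φ.toChart x) (0, a))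
  rw [← h, ψ.frame_dy hx']

variable [FiniteDimensional ℝ Q]

/-- The Jacobian of the change of transverse coordinates between affine charts has vanishing
derivative. -/
lemma IsAffine.fderiv_jacobian {φ ψ : F.AdaptedChart} (hφ : φ.IsAffine D) (hψ : ψ.IsAffine D)
    {z : P × Q} (hz : z ∈ overlap φ ψ) : fderiv ℝ (jacobian φ ψ) z = 0 := by
  set x := φ.toChart.symm z with hx_def
  have hx : x ∈ φ.toChart.source := φ.toChart.map_target hz.1
  have hx' : x ∈ ψ.toChart.source := hz.2
  have hJ : DifferentiableAt ℝ (jacobian φ ψ) z :=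
    ((contDiffOn_jacobian φ ψ).contDiffAt ((isOpen_overlap φ ψ).mem_nhds hz)).differentiableAt
      (by simp)
  -- The Leibniz rule of `D` concerns scalar coefficients, so the frame of `φ` is expanded in the
  -- frame of `ψ`, the coefficients `c i` being coordinates of the Jacobian applied to `a`.
  set b := Module.finBasis ℝ Q
  refine ContinuousLinearMap.ext fun w => ContinuousLinearMap.ext fun a => ?_
  set c : Fin (Module.finrank ℝ Q) → M → ℝ := fun i y => b.coord i (coordChange φ ψ y a)
  have hcoord : ∀ i, ContDiff ℝ ∞ fun A : Q →L[ℝ] Q => b.coord i (A a) := fun i =>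
    (b.coord i).toContinuousLinearMap.contDiff.comp
      (ContinuousLinearMap.apply ℝ Q a).contDiff
  have hc : ∀ i, MDifferentiableAt I 𝓘(ℝ) (c i) x := fun i => by
    have h := (contMDiffOn_coordChange φ ψ).contMDiffAt
      ((φ.toChart.open_source.inter ψ.toChart.open_source).mem_nhds ⟨hx, hx'⟩)
    exact ((hcoord i).contMDiff.contMDiffAt.comp x h).mdifferentiableAt (by simp)
  obtain ⟨hsum, hD⟩ := covariantDerivative_sum_smul (D := D) Finset.univ
    (σ := fun i y => ψ.frame y (b i)) hc (fun i => ψ.mdifferentiableAt_frame hx' (b i))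
  have hev : ∀ᶠ y in 𝓝 x, φ.frame y a = (∑ i, c i • fun y => ψ.frame y (b i)) y := by
    filter_upwards [φ.toChart.open_source.mem_nhds hx, ψ.toChart.open_source.mem_nhds hx']
      with y hy hy'
    rw [frame_eq_frame_coordChange φ ψ hy hy']
    conv_lhs => rw [← b.sum_repr (coordChange φ ψ y a), map_sum]
    rw [Finset.sum_apply]
    refine Finset.sum_congr rfl fun i _ => ?_
    rw [map_smul]
    rfl
  have h0 := D.isCovariantDerivativeOnUniv.congr_of_eventuallyEq
    (φ.mdifferentiableAt_frame hx a) hsum univ_mem hev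
  -- Both frames are parallel, so of the expanded covariant derivative only the terms with the
  -- differentials of the coefficients survive, and their sum is zero.
  have hzero : ∑ i, (mvfderiv I (c i) x).smulRight (ψ.frame x (b i)) = 0 := by
    have h1 := h0.symm.trans (hφ x hx a)
    rw [hD] at h1
    rw [← h1]
    refine Finset.sum_congr rfl fun i _ => ?_
    rw [hψ x hx' (b i), smul_zero, zero_add]
  have hc0 : ∀ i v, mvfderiv I (c i) x v = 0 := by
    intro i v
    have h1 := congrArg (ψ.dy x) (DFunLike.congr_fun hzero v)
    have h2 : ∑ i, mvfderiv I (c i) x v • b i = 0 := by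
      rw [sum_apply, map_sum] at h1
      simpa [ψ.dy_frame hx'] using h1
    exact Fintype.linearIndependent_iff.1 b.linearIndependent _ h2 i
  refine b.ext_elem fun i => ?_
  have hk : HasFDerivAt (fun z => b.coord i (jacobian φ ψ z a))
      (((b.coord i).toContinuousLinearMap.comp (ContinuousLinearMap.apply ℝ Q a)).comp
        (fderiv ℝ (jacobian φ ψ) z)) z :=
    ((b.coord i).toContinuousLinearMap.comp
      (ContinuousLinearMap.apply ℝ Q a)).hasFDerivAt.comp z hJ.hasFDerivAt
  -- The vanishing was obtained on `M`; the chain rule through the inverse chart carries it to the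
  -- coordinates of `φ`.
  have hk' : HasMFDerivAt 𝓘(ℝ, P × Q) 𝓘(ℝ) (c i ∘ φ.toChart.symm) z
      ((mfderiv I 𝓘(ℝ) (c i) x).comp (mfderiv 𝓘(ℝ, P × Q) I φ.toChart.symm z)) :=
    (hc i).hasMFDerivAt.comp z
      (φ.mdifferentiable.mdifferentiableAt_symm hz.1).hasMFDerivAt
  have hEq : (fun z => b.coord i (jacobian φ ψ z a)) =ᶠ[𝓝 z] c i ∘ φ.toChart.symm := by
    filter_upwards [φ.toChart.open_target.mem_nhds hz.1] with z' hz'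
    change b.coord i (jacobian φ ψ z' a) =
      b.coord i (jacobian φ ψ (φ.toChart (φ.toChart.symm z')) a)
    rw [φ.toChart.right_inv hz']
  have h1 := DFunLike.congr_fun (hk.unique (hk'.hasFDerivAt.congr_of_eventuallyEq hEq)) w
  have h2 := hc0 i (mfderiv 𝓘(ℝ, P × Q) I φ.toChart.symm z w)
  have h3 := h1.trans h2
  simpa using h3

end AdaptedChart

end Affine

end Foliation

namespace Foliation

/-! ### The complex structure and the lifted metric in charts induced by affine charts. -/

section NormalLiftComponents

variable {E : Type*} [NormedAddCommGroup E] [NormedSpace ℝ E]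
  {H : Type*} [TopologicalSpace H] {I : ModelWithCorners ℝ E H}
  {M : Type*} [TopologicalSpace M] [ChartedSpace H M]
  {P : Type*} [NormedAddCommGroup P] [NormedSpace ℝ P]
  {Q : Type*} [NormedAddCommGroup Q] [NormedSpace ℝ Q]
  {F : Foliation I M P Q} {D : CovariantDerivative I Q F.NormalSpace}

namespace AdaptedChart

lemma normalAdapted_mem_source (φ : F.AdaptedChart) (v : F.NormalBundle) :
    v ∈ φ.normalAdapted.toChart.source ↔ v.proj ∈ φ.toChart.source :=
  φ.mem_normalChart_source v

lemma toChart_normalAdapted_symm_proj (φ : F.AdaptedChart) {z : P × (Q × Q)}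
    (hz : z ∈ φ.normalAdapted.toChart.target) :
    (φ.normalAdapted.toChart.symm z).proj ∈ φ.toChart.source ∧
      φ.toChart (φ.normalAdapted.toChart.symm z).proj = (z.1, z.2.1) ∧
      φ.dy _ (φ.normalAdapted.toChart.symm z).2 = z.2.2 := by
  have h := φ.normalAdapted.toChart.right_inv hz
  refine ⟨(φ.normalAdapted_mem_source _).1 (φ.normalAdapted.toChart.map_target hz), ?_, ?_⟩
  · exact Prod.ext (congrArg (fun w : P × (Q × Q) => w.1) h)
      (congrArg (fun w : P × (Q × Q) => w.2.1) h)
  · exact congrArg (fun w : P × (Q × Q) => w.2.2) h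

lemma base_mem_target (φ : F.AdaptedChart) {z : P × (Q × Q)}
    (hz : z ∈ φ.normalAdapted.toChart.target) : (z.1, z.2.1) ∈ φ.toChart.target := by
  obtain ⟨h1, h2, -⟩ := φ.toChart_normalAdapted_symm_proj hz
  rw [← h2]
  exact φ.toChart.map_source h1

lemma normalAdapted_symm_proj (φ : F.AdaptedChart) {z : P × (Q × Q)}
    (hz : z ∈ φ.normalAdapted.toChart.target) :
    (φ.normalAdapted.toChart.symm z).proj = φ.toChart.symm (z.1, z.2.1) := by
  obtain ⟨h1, h2, -⟩ := φ.toChart_normalAdapted_symm_proj hz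
  rw [← h2, φ.toChart.left_inv h1]

lemma mem_normalAdapted_target (φ : F.AdaptedChart) {z : P × Q} (hz : z ∈ φ.toChart.target)
    (u : Q) : (z.1, z.2, u) ∈ φ.normalAdapted.toChart.target := by
  have hx := φ.toChart.map_target hz
  have h := φ.normalAdapted.toChart.map_source ((φ.normalAdapted_mem_source
    ⟨φ.toChart.symm z, φ.frame (φ.toChart.symm z) u⟩).2 hx)
  have h' : φ.normalAdapted.toChart ⟨φ.toChart.symm z, φ.frame (φ.toChart.symm z) u⟩ =
      ((φ.toChart (φ.toChart.symm z)).1, (φ.toChart (φ.toChart.symm z)).2,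
        φ.dy (φ.toChart.symm z) (φ.frame (φ.toChart.symm z) u)) :=
    φ.normalChart_apply _
  rw [h', φ.toChart.right_inv hz, φ.dy_frame hx] at h
  exact h

lemma base_mem_overlap (φ ψ : F.AdaptedChart) {z : P × (Q × Q)}
    (hz : z ∈ overlap φ.normalAdapted ψ.normalAdapted) : (z.1, z.2.1) ∈ overlap φ ψ := by
  refine ⟨φ.base_mem_target hz.1, ?_⟩
  rw [mem_preimage, ← φ.normalAdapted_symm_proj hz.1]
  exact (ψ.normalAdapted_mem_source _).1 hz.2

/-- The fibre coordinate `dy` of a normal vector transforms by the differential of the change of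
`y`. -/
lemma transition_normalAdapted (φ ψ : F.AdaptedChart) {z : P × (Q × Q)}
    (hz : z ∈ overlap φ.normalAdapted ψ.normalAdapted) :
    transition φ.normalAdapted ψ.normalAdapted z =
      (transition φ ψ (z.1, z.2.1), jacobian φ ψ (z.1, z.2.1) z.2.2) := by
  obtain ⟨h1, h2, h3⟩ := φ.toChart_normalAdapted_symm_proj hz.1
  have h4 := φ.normalAdapted_symm_proj hz.1
  have h5 : (φ.normalAdapted.toChart.symm z).proj ∈ ψ.toChart.source :=
    (ψ.normalAdapted_mem_source _).1 hz.2
  have h6 := dy_frame_transition φ ψ h1 h5 z.2.2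
  rw [← h3, φ.frame_dy h1, h2, h3] at h6
  refine Prod.ext ?_ h6
  change (ψ.toChart (φ.normalAdapted.toChart.symm z).proj).2 = _
  rw [h4]
  rfl

variable [FiniteDimensional ℝ Q]

/-- Differentiating `A(y) dy` gives a term `A'(y) dy` and a term `A(y) d(dy)`. The first vanishes
between affine charts, which leaves the block diagonal map `A ⊕ A`. -/
lemma IsAffine.jacobian_normalAdapted {φ ψ : F.AdaptedChart} (hφ : φ.IsAffine D)
    (hψ : ψ.IsAffine D) {z : P × (Q × Q)} (hz : z ∈ overlap φ.normalAdapted ψ.normalAdapted)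
    (c : Q × Q) : jacobian φ.normalAdapted ψ.normalAdapted z c =
      (jacobian φ ψ (z.1, z.2.1) c.1, jacobian φ ψ (z.1, z.2.1) c.2) := by
  have hb := base_mem_overlap φ ψ hz
  have hn := (isOpen_overlap φ ψ).mem_nhds hb
  let r : P × (Q × Q) →L[ℝ] P × Q := (ContinuousLinearMap.fst ℝ P (Q × Q)).prod
    ((ContinuousLinearMap.fst ℝ Q Q).comp (ContinuousLinearMap.snd ℝ P (Q × Q)))
  let s : P × (Q × Q) →L[ℝ] Q :=
    (ContinuousLinearMap.snd ℝ Q Q).comp (ContinuousLinearMap.snd ℝ P (Q × Q))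
  have hT : HasFDerivAt (transition φ ψ) (fderiv ℝ (transition φ ψ) (z.1, z.2.1)) (r z) :=
    (((contDiffOn_transition φ ψ).contDiffAt hn).differentiableAt (by simp)).hasFDerivAt
  have hJ : HasFDerivAt (jacobian φ ψ) (0 : P × Q →L[ℝ] Q →L[ℝ] Q) (r z) := by
    have h := (((contDiffOn_jacobian φ ψ).contDiffAt hn).differentiableAt (by simp)).hasFDerivAt
    rwa [hφ.fderiv_jacobian hψ hb] at h
  have h1 : HasFDerivAt (fun w => transition φ ψ (r w))
      ((fderiv ℝ (transition φ ψ) (z.1, z.2.1)).comp r) z := hT.comp z r.hasFDerivAt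
  have h2 : HasFDerivAt (fun w => jacobian φ ψ (r w))
      ((0 : P × Q →L[ℝ] Q →L[ℝ] Q).comp r) z := hJ.comp z r.hasFDerivAt
  have h3 := h1.prodMk (h2.clm_apply s.hasFDerivAt)
  have hE : transition φ.normalAdapted ψ.normalAdapted =ᶠ[𝓝 z]
      fun w => (transition φ ψ (r w), jacobian φ ψ (r w) (s w)) := by
    filter_upwards [(isOpen_overlap φ.normalAdapted ψ.normalAdapted).mem_nhds hz] with w hw
    exact transition_normalAdapted φ ψ hw
  rw [jacobian_apply, (h3.congr_of_eventuallyEq hE).fderiv]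
  refine Prod.ext rfl ?_
  exact add_zero (jacobian φ ψ (z.1, z.2.1) c.2)

/-- In the frames induced by affine charts, the coordinate changes of the normal bundle of the
lifted foliation are complexifications of real maps. -/
lemma IsAffine.dy_frame_normalAdapted {φ ψ : F.AdaptedChart} (hφ : φ.IsAffine D)
    (hψ : ψ.IsAffine D) {v : F.NormalBundle} (hv : v.proj ∈ φ.toChart.source)
    (hv' : v.proj ∈ ψ.toChart.source) (c : Q × Q) :
    ψ.normalAdapted.dy v (φ.normalAdapted.frame v c) =
      (ψ.dy v.proj (φ.frame v.proj c.1), ψ.dy v.proj (φ.frame v.proj c.2)) := by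
  have hs := (φ.normalAdapted_mem_source v).2 hv
  have hs' := (ψ.normalAdapted_mem_source v).2 hv'
  have hz : φ.normalAdapted.toChart v ∈ overlap φ.normalAdapted ψ.normalAdapted := by
    refine ⟨φ.normalAdapted.toChart.map_source hs, ?_⟩
    rw [mem_preimage, φ.normalAdapted.toChart.left_inv hs]
    exact hs'
  rw [dy_frame_transition _ _ hs hs', dy_frame_transition _ _ hv hv',
    dy_frame_transition _ _ hv hv']
  exact hφ.jacobian_normalAdapted hψ hz c

end AdaptedChart

lemma affineChart_mem (hD : F.IsFoliatedFlat D) (x : M) :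
    x ∈ (affineChart hD x).toChart.source := (hD x).choose_spec.1

lemma affineChart_isAffine (hD : F.IsFoliatedFlat D) (x : M) :
    (affineChart hD x).IsAffine D := (hD x).choose_spec.2

variable [FiniteDimensional ℝ Q]

/-- Independence of the affine chart chosen in the definition: the coordinate change `A ⊕ A`
commutes with `mulI Q`. -/
lemma normalJ_frame (hD : F.IsFoliatedFlat D) {φ : F.AdaptedChart} (hφ : φ.IsAffine D)
    {v : F.NormalBundle} (hv : v.proj ∈ φ.toChart.source) (c : Q × Q) :
    normalJ hD v (φ.normalAdapted.frame v c) = φ.normalAdapted.frame v (mulI Q c) := by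
  have hψ := affineChart_isAffine hD v.proj
  have hv' := affineChart_mem hD v.proj
  set ψ := affineChart hD v.proj with hψ_def
  have h : ψ.normalAdapted.dy v (φ.normalAdapted.frame v (mulI Q c)) =
      mulI Q (ψ.normalAdapted.dy v (φ.normalAdapted.frame v c)) := by
    rw [hφ.dy_frame_normalAdapted hψ hv hv', hφ.dy_frame_normalAdapted hψ hv hv']
    simp [mulI]
  change ψ.normalAdapted.frame v (mulI Q (ψ.normalAdapted.dy v (φ.normalAdapted.frame v c))) = _
  rw [← h, ψ.normalAdapted.frame_dy ((ψ.normalAdapted_mem_source v).2 hv')]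

lemma liftedMetric_frame (hD : F.IsFoliatedFlat D) (g : F.NormalForm) {φ : F.AdaptedChart}
    (hφ : φ.IsAffine D) {v : F.NormalBundle} (hv : v.proj ∈ φ.toChart.source) (a b : Q × Q) :
    liftedMetric hD g v (φ.normalAdapted.frame v a) (φ.normalAdapted.frame v b) =
      g v.proj (φ.frame v.proj a.1) (φ.frame v.proj b.1) +
        g v.proj (φ.frame v.proj a.2) (φ.frame v.proj b.2) := by
  have hψ := affineChart_isAffine hD v.proj
  have hv' := affineChart_mem hD v.proj
  set ψ := affineChart hD v.proj with hψ_def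
  change g v.proj (ψ.frame v.proj (ψ.normalAdapted.dy v (φ.normalAdapted.frame v a)).1)
      (ψ.frame v.proj (ψ.normalAdapted.dy v (φ.normalAdapted.frame v b)).1) +
    g v.proj (ψ.frame v.proj (ψ.normalAdapted.dy v (φ.normalAdapted.frame v a)).2)
      (ψ.frame v.proj (ψ.normalAdapted.dy v (φ.normalAdapted.frame v b)).2) = _
  rw [hφ.dy_frame_normalAdapted hψ hv hv', hφ.dy_frame_normalAdapted hψ hv hv']
  simp only [ψ.frame_dy hv']

lemma component_liftedMetric (hD : F.IsFoliatedFlat D) (g : F.NormalForm) {φ : F.AdaptedChart}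
    (hφ : φ.IsAffine D) {z : P × (Q × Q)} (hz : z ∈ φ.normalAdapted.toChart.target)
    (a b : Q × Q) : φ.normalAdapted.component (liftedMetric hD g) z a b =
      φ.component g (z.1, z.2.1) a.1 b.1 + φ.component g (z.1, z.2.1) a.2 b.2 := by
  rw [AdaptedChart.component, liftedMetric_frame hD g hφ
    (φ.toChart_normalAdapted_symm_proj hz).1, φ.normalAdapted_symm_proj hz]
  rfl

/-- Since `J` sends `(a₁, a₂)` to `(-a₂, a₁)`, the form pairs horizontal with vertical parts: `ω = ∑
g_ij dyⁱ ∧ d(dyʲ)` when `g` is symmetric. -/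
lemma component_fundamentalForm (hD : F.IsFoliatedFlat D) (g : F.NormalForm) {φ : F.AdaptedChart}
    (hφ : φ.IsAffine D) {z : P × (Q × Q)} (hz : z ∈ φ.normalAdapted.toChart.target)
    (a b : Q × Q) :
    φ.normalAdapted.component
        (F.normalFoliation.fundamentalForm (normalJ hD) (liftedMetric hD g)) z a b =
      φ.component g (z.1, z.2.1) a.1 b.2 - φ.component g (z.1, z.2.1) a.2 b.1 := by
  have hv := (φ.toChart_normalAdapted_symm_proj hz).1
  change liftedMetric hD g _ (normalJ hD _ (φ.normalAdapted.frame _ a))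
    (φ.normalAdapted.frame _ b) = _
  rw [normalJ_frame hD hφ hv]
  refine (component_liftedMetric hD g hφ hz (mulI Q a) b).trans ?_
  simp [mulI, AdaptedChart.component]
  ring

end NormalLiftComponents

end Foliation

/-! ### Hessians and fields of bilinear forms with totally symmetric derivative. -/

namespace Foliation

/-- The third derivative of a smooth function, as the derivative of its Hessian, is symmetric. -/
lemma fderiv_hessian_swap {Q : Type*} [NormedAddCommGroup Q] [NormedSpace ℝ Q] {h : Q → ℝ}
    {y : Q} (hh : ContDiffAt ℝ ∞ h y) (a b c : Q) :
    fderiv ℝ (fun y => fderiv ℝ (fderiv ℝ h) y a b) y c =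
      fderiv ℝ (fun y => fderiv ℝ (fderiv ℝ h) y c b) y a := by
  -- With `b` fixed, the Hessian in `a, b` is the derivative along `a` of this function, so the
  -- exchange of `a` and `c` is the symmetry of its second derivative.
  have hf : ContDiffAt ℝ ∞ (fun y => fderiv ℝ h y b) y :=
    (hh.fderiv_right (m := ∞) (by simp)).clm_apply contDiffAt_const
  have hev : ∀ᶠ x in 𝓝 y, ∀ a, fderiv ℝ (fderiv ℝ h) x a b =
      fderiv ℝ (fun y => fderiv ℝ h y b) x a := by
    have h2 : ∀ᶠ x in 𝓝 y, ContDiffAt ℝ 2 h x :=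
      (hh.of_le (WithTop.coe_le_coe.2 (le_top (a := (2 : ℕ∞))))).eventually (by simp)
    filter_upwards [h2] with x hx a
    have hd : DifferentiableAt ℝ (fderiv ℝ h) x :=
      (hx.fderiv_right (m := 1) (by norm_num)).differentiableAt (by simp)
    rw [(hd.hasFDerivAt.clm_apply (hasFDerivAt_const b x)).fderiv]
    simp
  have hd2 : DifferentiableAt ℝ (fderiv ℝ (fun y => fderiv ℝ h y b)) y :=
    (hf.fderiv_right (m := ∞) (by simp)).differentiableAt (by simp)
  have key : ∀ a c, fderiv ℝ (fun y => fderiv ℝ (fderiv ℝ h) y a b) y c =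
      fderiv ℝ (fderiv ℝ (fun y => fderiv ℝ h y b)) y c a := by
    intro a c
    have hE : (fun y => fderiv ℝ (fderiv ℝ h) y a b) =ᶠ[𝓝 y]
        fun x => fderiv ℝ (fun y => fderiv ℝ h y b) x a := hev.mono fun x hx => hx a
    rw [hE.fderiv_eq, (hd2.hasFDerivAt.clm_apply (hasFDerivAt_const a y)).fderiv]
    simp
  have hsymm : IsSymmSndFDerivAt ℝ (fun y => fderiv ℝ h y b) y := hf.isSymmSndFDerivAt (by
    rw [minSmoothness_of_isRCLikeNormedField]
    exact WithTop.coe_le_coe.2 (le_top (a := (2 : ℕ∞))))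
  rw [key, key]
  exact hsymm c a

/-- A smooth field of symmetric bilinear forms on a convex open set with totally symmetric
derivative is a Hessian. -/
lemma exists_hessian_eq {Q : Type*} [NormedAddCommGroup Q] [NormedSpace ℝ Q] {s : Set Q}
    (hs : Convex ℝ s) (hso : IsOpen s) {G : Q → Q →L[ℝ] Q →L[ℝ] ℝ} (hG : ContDiffOn ℝ ∞ G s)
    (hsymm : ∀ y ∈ s, ∀ a b, G y a b = G y b a)
    (hcod : ∀ y ∈ s, ∀ a b, fderiv ℝ G y a b = fderiv ℝ G y b a) :
    ∃ h : Q → ℝ, ContDiffOn ℝ ∞ h s ∧ ∀ y ∈ s, fderiv ℝ (fderiv ℝ h) y = G y := by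
  -- First Poincaré lemma: `G`, seen as a 1-form with values in the dual of `Q`, is closed by
  -- `hcod`, so it is the derivative of some `f`.
  obtain ⟨f, hf⟩ := hs.exists_forall_hasFDerivAt_of_fderiv_symmetric hso
    (hG.differentiableOn (by simp)) hcod
  have hfs : ContDiffOn ℝ ∞ f s := (contDiffOn_infty_iff_fderiv_of_isOpen hso).2
    ⟨fun y hy => (hf y hy).differentiableAt.differentiableWithinAt,
      hG.congr fun y hy => (hf y hy).fderiv⟩
  -- Second Poincaré lemma: `f` is itself a 1-form, closed because its derivative `G` is symmetric.
  obtain ⟨h, hh⟩ := hs.exists_forall_hasFDerivAt_of_fderiv_symmetric hso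
    (hfs.differentiableOn (by simp)) fun y hy a b => by
      rw [(hf y hy).fderiv]
      exact hsymm y hy a b
  refine ⟨h, (contDiffOn_infty_iff_fderiv_of_isOpen hso).2
    ⟨fun y hy => (hh y hy).differentiableAt.differentiableWithinAt,
      hfs.congr fun y hy => (hh y hy).fderiv⟩, fun y hy => ?_⟩
  have hE : fderiv ℝ h =ᶠ[𝓝 y] f := by
    filter_upwards [hso.mem_nhds hy] with x hx
    exact (hh x hx).fderiv
  rw [hE.fderiv_eq, (hf y hy).fderiv]

/-! ### Foliated Hessian metrics and foliated Kähler lifts. -/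

section HessianKahler

variable {E : Type*} [NormedAddCommGroup E] [NormedSpace ℝ E]
  {H : Type*} [TopologicalSpace H] {I : ModelWithCorners ℝ E H}
  {M : Type*} [TopologicalSpace M] [ChartedSpace H M]
  {P : Type*} [NormedAddCommGroup P] [NormedSpace ℝ P]
  {Q : Type*} [NormedAddCommGroup Q] [NormedSpace ℝ Q]
  {F : Foliation I M P Q} {D : CovariantDerivative I Q F.NormalSpace}

namespace AdaptedChart

/-- The restriction of an adapted chart to an open set of coordinates. -/
def restrictTarget (φ : F.AdaptedChart) (U : Set (P × Q)) (hU : IsOpen U) : F.AdaptedChart where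
  toChart := (φ.toChart.symm.restrOpen U hU).symm
  isAdapted := by
    have hsub : (φ.toChart.symm.restrOpen U hU).symm.source ⊆ φ.toChart.source := fun x hx => hx.1
    exact ⟨φ.isAdapted.contMDiffOn.mono hsub,
      φ.isAdapted.contMDiffOn_symm.mono fun z hz => hz.1,
      fun x hx v => φ.isAdapted.mem_iff x (hsub hx) v⟩

lemma restrictTarget_target (φ : F.AdaptedChart) {U : Set (P × Q)} (hU : IsOpen U) :
    (φ.restrictTarget U hU).toChart.target = φ.toChart.target ∩ U := rfl

lemma mem_restrictTarget_source (φ : F.AdaptedChart) {U : Set (P × Q)} (hU : IsOpen U) {x : M}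
    (hx : x ∈ φ.toChart.source) (hxU : φ.toChart x ∈ U) :
    x ∈ (φ.restrictTarget U hU).toChart.source := ⟨hx, hxU⟩

lemma component_restrictTarget (φ : F.AdaptedChart) {U : Set (P × Q)} (hU : IsOpen U)
    (σ : F.NormalForm) (z : P × Q) (a b : Q) :
    (φ.restrictTarget U hU).component σ z a b = φ.component σ z a b := rfl

lemma IsAffine.restrictTarget {φ : F.AdaptedChart} (hφ : φ.IsAffine D) {U : Set (P × Q)}
    (hU : IsOpen U) : (φ.restrictTarget U hU).IsAffine D := fun x hx a => hφ x hx.1 a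

lemma component_zero_left (φ : F.AdaptedChart) (σ : F.NormalForm) (z : P × Q) (b : Q) :
    φ.component σ z 0 b = 0 := by
  simp [component]

lemma component_zero_right (φ : F.AdaptedChart) (σ : F.NormalForm) (z : P × Q) (a : Q) :
    φ.component σ z a 0 = 0 := by
  simp [component]

end AdaptedChart

namespace IsFoliatedMetric

lemma component_comm {g : F.NormalForm} (hg : F.IsFoliatedMetric g)
    (φ : F.AdaptedChart) (z : P × Q) (a b : Q) :
    φ.component g z a b = φ.component g z b a := hg.symm _ _ _

lemma fderiv_component_comm {g : F.NormalForm} (hg : F.IsFoliatedMetric g)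
    (φ : F.AdaptedChart) (z : P × Q) (a b : Q) :
    fderiv ℝ (fun w => φ.component g w a b) z = fderiv ℝ (fun w => φ.component g w b a) z :=
  congrArg (fun f => fderiv ℝ f z) (funext fun w => hg.component_comm φ w a b)

lemma differentiableAt_component {g : F.NormalForm} (hg : F.IsFoliatedMetric g)
    (φ : F.AdaptedChart) {z : P × Q} (hz : z ∈ φ.toChart.target)
    (a b : Q) : DifferentiableAt ℝ (fun w => φ.component g w a b) z :=
  ((hg.smooth φ a b).contDiffAt (φ.toChart.open_target.mem_nhds hz)).differentiableAt (by simp)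

/-- On a ball in the domain of an adapted chart, the components of a foliated metric depend only on
the transverse coordinates. -/
lemma component_eq_of_ball {g : F.NormalForm} (hg : F.IsFoliatedMetric g)
    (φ : F.AdaptedChart) {z : P × Q} {r : ℝ}
    (hball : Metric.ball z r ⊆ φ.toChart.target) {w : P × Q} (hw : w ∈ Metric.ball z r)
    (a b : Q) : φ.component g w a b = φ.component g (z.1, w.2) a b := by
  -- In the max norm the ball is a product of balls, so its leafwise slices are convex and a
  -- vanishing leafwise derivative makes the component constant on them.
  rw [Metric.mem_ball, Prod.dist_eq, max_lt_iff] at hw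
  have hr : 0 < r := dist_nonneg.trans_lt hw.1
  have hD : ∀ p ∈ Metric.ball z.1 r,
      HasFDerivAt (fun p => φ.component g (p, w.2) a b) (0 : P →L[ℝ] ℝ) p := by
    intro p hp
    have hpz : (p, w.2) ∈ φ.toChart.target := hball (by
      rw [Metric.mem_ball, Prod.dist_eq, max_lt_iff]
      exact ⟨hp, hw.2⟩)
    have h := (hg.differentiableAt_component φ hpz a b).hasFDerivAt.comp
      (f := fun p : P => (p, w.2)) p (hasFDerivAt_prodMk_left p w.2)
    refine h.congr_fderiv (ContinuousLinearMap.ext fun p' => ?_)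
    exact AdaptedChart.HasBasicComponents.fderiv_inl (hg.basic φ) (hg.smooth φ) hpz a b p'
  exact (convex_ball z.1 r).is_const_of_fderivWithin_eq_zero (𝕜 := ℝ)
    (fun p hp => (hD p hp).differentiableAt.differentiableWithinAt)
    (fun p hp => (hD p hp).hasFDerivWithinAt.fderivWithin (Metric.isOpen_ball.uniqueDiffWithinAt hp))
    hw.1 (Metric.mem_ball_self hr)

end IsFoliatedMetric

/-- The derivative of a component of the metric, lifted to the normal bundle. -/
lemma hasFDerivAt_component_base {g : F.NormalForm} (hg : F.IsFoliatedMetric g) (φ : F.AdaptedChart)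
    {z : P × (Q × Q)} (hz : (z.1, z.2.1) ∈ φ.toChart.target) (a b : Q) :
    HasFDerivAt (fun w : P × (Q × Q) => φ.component g (w.1, w.2.1) a b)
      ((fderiv ℝ (fun w => φ.component g w a b) (z.1, z.2.1)).comp
        ((ContinuousLinearMap.fst ℝ P (Q × Q)).prod
          ((ContinuousLinearMap.fst ℝ Q Q).comp (ContinuousLinearMap.snd ℝ P (Q × Q))))) z :=
  (hg.differentiableAt_component φ hz a b).hasFDerivAt.comp
    (f := fun w : P × (Q × Q) => (w.1, w.2.1)) z
    (hasFDerivAt_fst.prodMk (hasFDerivAt_fst.comp z hasFDerivAt_snd))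

lemma contDiffOn_component_base {g : F.NormalForm} (hg : F.IsFoliatedMetric g)
    (φ : F.AdaptedChart) (a b : Q) :
    ContDiffOn ℝ ∞ (fun z : P × (Q × Q) => φ.component g (z.1, z.2.1) a b)
      φ.normalAdapted.toChart.target :=
  (hg.smooth φ a b).comp
    (contDiff_fst.prodMk (contDiff_fst.comp contDiff_snd)).contDiffOn
    fun _ hz => φ.base_mem_target hz

lemma eventually_component_base {g : F.NormalForm} (hg : F.IsFoliatedMetric g)
    (φ : F.AdaptedChart) (a b : Q) {z : P × (Q × Q)}
    (hz : z ∈ φ.normalAdapted.toChart.target) :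
    ∀ᶠ w in 𝓝 z, w.2 = z.2 →
      φ.component g (w.1, w.2.1) a b = φ.component g (z.1, z.2.1) a b := by
  have hc : ContinuousAt (fun w : P × (Q × Q) => (w.1, w.2.1)) z := by fun_prop
  filter_upwards [hc.eventually (hg.basic φ a b _ (φ.base_mem_target hz))] with w hw hwz
  exact hw (congrArg Prod.fst hwz)

variable [FiniteDimensional ℝ Q]

lemma hasSmoothComponents_liftedMetric (hD : F.IsFoliatedFlat D) {g : F.NormalForm}
    (hg : F.IsFoliatedMetric g) {φ : F.AdaptedChart} (hφ : φ.IsAffine D) :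
    φ.normalAdapted.HasSmoothComponents (liftedMetric hD g) := fun a b =>
  ((contDiffOn_component_base hg φ a.1 b.1).add (contDiffOn_component_base hg φ a.2 b.2)).congr
    fun _ hz => component_liftedMetric hD g hφ hz a b

lemma hasBasicComponents_liftedMetric (hD : F.IsFoliatedFlat D) {g : F.NormalForm}
    (hg : F.IsFoliatedMetric g) {φ : F.AdaptedChart} (hφ : φ.IsAffine D) :
    φ.normalAdapted.HasBasicComponents (liftedMetric hD g) := fun a b z hz => by
  filter_upwards [eventually_component_base hg φ a.1 b.1 hz,
    eventually_component_base hg φ a.2 b.2 hz,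
    φ.normalAdapted.toChart.open_target.mem_nhds hz] with w h1 h2 hw hwz
  rw [component_liftedMetric hD g hφ hw, component_liftedMetric hD g hφ hz, h1 hwz, h2 hwz]

lemma hasSmoothComponents_fundamentalForm (hD : F.IsFoliatedFlat D) {g : F.NormalForm}
    (hg : F.IsFoliatedMetric g) {φ : F.AdaptedChart} (hφ : φ.IsAffine D) :
    φ.normalAdapted.HasSmoothComponents
    (F.normalFoliation.fundamentalForm (normalJ hD) (liftedMetric hD g)) := fun a b =>
  ((contDiffOn_component_base hg φ a.1 b.2).sub (contDiffOn_component_base hg φ a.2 b.1)).congr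
    fun _ hz => component_fundamentalForm hD g hφ hz a b

lemma hasBasicComponents_fundamentalForm (hD : F.IsFoliatedFlat D) {g : F.NormalForm}
    (hg : F.IsFoliatedMetric g) {φ : F.AdaptedChart} (hφ : φ.IsAffine D) :
    φ.normalAdapted.HasBasicComponents
    (F.normalFoliation.fundamentalForm (normalJ hD) (liftedMetric hD g)) := fun a b z hz => by
  filter_upwards [eventually_component_base hg φ a.1 b.2 hz,
    eventually_component_base hg φ a.2 b.1 hz,
    φ.normalAdapted.toChart.open_target.mem_nhds hz] with w h1 h2 hw hwz
  rw [component_fundamentalForm hD g hφ hw, component_fundamentalForm hD g hφ hz, h1 hwz, h2 hwz]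

/-- Only `c.1` enters because the coefficients `g_ij` are pulled back from `M` and do not depend on
`dy`. -/
lemma fderiv_component_fundamentalForm (hD : F.IsFoliatedFlat D) {g : F.NormalForm}
    (hg : F.IsFoliatedMetric g) {φ : F.AdaptedChart} (hφ : φ.IsAffine D)
    {z : P × (Q × Q)}
    (hz : z ∈ φ.normalAdapted.toChart.target) (a b c : Q × Q) :
    fderiv ℝ (fun w => φ.normalAdapted.component
        (F.normalFoliation.fundamentalForm (normalJ hD) (liftedMetric hD g)) w a b) z (0, c) =
      fderiv ℝ (fun w => φ.component g w a.1 b.2) (z.1, z.2.1) (0, c.1) -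
        fderiv ℝ (fun w => φ.component g w a.2 b.1) (z.1, z.2.1) (0, c.1) := by
  have hE : (fun w => φ.normalAdapted.component
      (F.normalFoliation.fundamentalForm (normalJ hD) (liftedMetric hD g)) w a b) =ᶠ[𝓝 z]
      fun w => φ.component g (w.1, w.2.1) a.1 b.2 - φ.component g (w.1, w.2.1) a.2 b.1 := by
    filter_upwards [φ.normalAdapted.toChart.open_target.mem_nhds hz] with w hw
    exact component_fundamentalForm hD g hφ hw a b
  have hz' := φ.base_mem_target hz
  rw [hE.fderiv_eq, ((hasFDerivAt_component_base hg φ hz' a.1 b.2).fun_sub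
    (hasFDerivAt_component_base hg φ hz' a.2 b.1)).fderiv]
  rfl

/-- If the first derivatives of the components of the metric in an affine chart are totally
symmetric, the fundamental form of the lifted metric is closed. -/
lemma cyclicDeriv_fundamentalForm_eq_zero (hD : F.IsFoliatedFlat D) {g : F.NormalForm}
    (hg : F.IsFoliatedMetric g) {φ : F.AdaptedChart} (hφ : φ.IsAffine D)
    {z : P × (Q × Q)}
    (hz : z ∈ φ.normalAdapted.toChart.target)
    (hcod : ∀ a b c : Q, fderiv ℝ (fun w => φ.component g w a b) (z.1, z.2.1) (0, c) =
      fderiv ℝ (fun w => φ.component g w c b) (z.1, z.2.1) (0, a)) (a b c : Q × Q) :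
    φ.normalAdapted.cyclicDeriv
      (F.normalFoliation.fundamentalForm (normalJ hD) (liftedMetric hD g)) z a b c = 0 := by
  -- Of the six terms, two involve each of the triples `(a.1, b.1, c.2)`, `(a.1, b.2, c.1)`, `(a.2,
  -- b.1, c.1)`, with opposite signs; total symmetry makes each pair cancel.
  rw [AdaptedChart.cyclicDeriv, fderiv_component_fundamentalForm hD hg hφ hz,
    fderiv_component_fundamentalForm hD hg hφ hz, fderiv_component_fundamentalForm hD hg hφ hz,
    hcod b.1 c.2 a.1, hg.fderiv_component_comm φ _ b.2 c.1, hcod c.1 b.2 a.1,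
    hcod c.1 a.2 b.1, hg.fderiv_component_comm φ _ c.2 a.1, hg.fderiv_component_comm φ _ a.2 b.1]
  ring

/-- Closedness is tested on two horizontal vectors and one vertical vector. The vertical one
differentiates coefficients independent of `dy`, so two terms remain. Points of the zero section
suffice. -/
lemma fderiv_component_swap_of_closed (hD : F.IsFoliatedFlat D) {g : F.NormalForm}
    (hg : F.IsFoliatedMetric g) {φ : F.AdaptedChart} (hφ : φ.IsAffine D)
    (hcl : F.normalFoliation.IsTransverselyClosed
      (F.normalFoliation.fundamentalForm (normalJ hD) (liftedMetric hD g)))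
    {z : P × Q} (hz : z ∈ φ.toChart.target) (a b c : Q) :
    fderiv ℝ (fun w => φ.component g w a b) z (0, c) =
      fderiv ℝ (fun w => φ.component g w c b) z (0, a) := by
  have hz' := φ.mem_normalAdapted_target hz 0
  have h := hcl φ.normalAdapted _ hz' (c, 0) (a, 0) (0, b)
  rw [fderiv_component_fundamentalForm hD hg hφ hz', fderiv_component_fundamentalForm hD hg hφ hz',
    fderiv_component_fundamentalForm hD hg hφ hz'] at h
  simp only [AdaptedChart.component_zero_left, AdaptedChart.component_zero_right,
    fderiv_fun_const, Pi.zero_apply, zero_apply, sub_zero, zero_sub, add_zero] at h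
  rw [hg.fderiv_component_comm φ _ b c] at h
  linarith

/-- The lift of a foliated metric to the normal bundle is a foliated metric. -/
theorem isFoliatedMetric_liftedMetric (hD : F.IsFoliatedFlat D) {g : F.NormalForm}
    (hg : F.IsFoliatedMetric g) : F.normalFoliation.IsFoliatedMetric (liftedMetric hD g) where
  symm v ξ η := congrArg₂ (· + ·) (hg.symm _ _ _) (hg.symm _ _ _)
  pos v ξ hξ := by
    have hφ := affineChart_isAffine hD v.proj
    have hv := affineChart_mem hD v.proj
    set φ := affineChart hD v.proj with hφ_def
    rw [← φ.normalAdapted.frame_dy ((φ.normalAdapted_mem_source v).2 hv) ξ] at hξ ⊢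
    set c := φ.normalAdapted.dy v ξ with hc_def
    rw [liftedMetric_frame hD g hφ hv]
    have hnonneg : ∀ a : Q, 0 ≤ g v.proj (φ.frame v.proj a) (φ.frame v.proj a) := fun a => by
      by_cases h : φ.frame v.proj a = 0
      · simp [h]
      · exact (hg.pos _ _ h).le
    have hpos : ∀ a : Q, a ≠ 0 → 0 < g v.proj (φ.frame v.proj a) (φ.frame v.proj a) :=
      fun a ha => hg.pos _ _ fun h => ha (by rw [← φ.dy_frame hv a, h, map_zero])
    by_cases h1 : c.1 = 0
    · have h2 : c.2 ≠ 0 := fun h2 => hξ (by rw [show c = 0 from Prod.ext h1 h2, map_zero])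
      exact add_pos_of_nonneg_of_pos (hnonneg _) (hpos _ h2)
    · exact add_pos_of_pos_of_nonneg (hpos _ h1) (hnonneg _)
  -- `Ψ` is an arbitrary adapted chart of the normal bundle; near each of its points it is compared
  -- with a chart induced by an affine one.
  smooth Ψ a b z hz := by
    set v := Ψ.toChart.symm z
    exact (AdaptedChart.smoothAt_of_overlap Ψ (affineChart hD v.proj).normalAdapted
      (hasSmoothComponents_liftedMetric hD hg (affineChart_isAffine hD v.proj)) a b
      ⟨hz, (AdaptedChart.normalAdapted_mem_source _ v).2
        (affineChart_mem hD v.proj)⟩).contDiffWithinAt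
  basic Ψ a b z hz := by
    set v := Ψ.toChart.symm z
    exact AdaptedChart.basicAt_of_overlap Ψ (affineChart hD v.proj).normalAdapted
      (hasBasicComponents_liftedMetric hD hg (affineChart_isAffine hD v.proj)) a b
      ⟨hz, (AdaptedChart.normalAdapted_mem_source _ v).2 (affineChart_mem hD v.proj)⟩

/-- The normal bundle of a transversely affine foliation is transversely holomorphic. -/
theorem isFoliatedComplex_normalJ (hD : F.IsFoliatedFlat D) :
    F.normalFoliation.IsFoliatedComplex (normalJ hD) := fun v =>
  ⟨(affineChart hD v.proj).normalAdapted,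
    (AdaptedChart.normalAdapted_mem_source _ v).2 (affineChart_mem hD v.proj), fun w hw c =>
      normalJ_frame hD (affineChart_isAffine hD v.proj)
        ((AdaptedChart.normalAdapted_mem_source _ w).1 hw) c⟩

/-- The complex structure exchanges the two summands of the lifted metric, and its sign occurs
twice. -/
lemma liftedMetric_normalJ_normalJ (hD : F.IsFoliatedFlat D) (g : F.NormalForm)
    (v : F.NormalBundle) (ξ η : F.normalFoliation.NormalSpace v) :
    liftedMetric hD g v (normalJ hD v ξ) (normalJ hD v η) = liftedMetric hD g v ξ η := by
  have hφ := affineChart_isAffine hD v.proj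
  have hv := affineChart_mem hD v.proj
  set φ := affineChart hD v.proj with hφ_def
  have hs := (φ.normalAdapted_mem_source v).2 hv
  rw [← φ.normalAdapted.frame_dy hs ξ, ← φ.normalAdapted.frame_dy hs η, normalJ_frame hD hφ hv,
    normalJ_frame hD hφ hv, liftedMetric_frame hD g hφ hv, liftedMetric_frame hD g hφ hv]
  simp [mulI, add_comm]

theorem IsFoliatedHessian.isFoliatedKahler (hD : F.IsFoliatedFlat D) {g : F.NormalForm}
    (hH : F.IsFoliatedHessian D g) :
    F.normalFoliation.IsFoliatedKahler (normalJ hD) (liftedMetric hD g) where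
  complex := isFoliatedComplex_normalJ hD
  metric := isFoliatedMetric_liftedMetric hD hH.1
  hermitian := liftedMetric_normalJ_normalJ hD g
  closed Ψ z hz a b c := by
    obtain ⟨hg, hH⟩ := hH
    -- By naturality of the transverse exterior derivative it is enough to compute in the chart
    -- induced by a Hessian chart around the base point.
    obtain ⟨φ, hx, hφ, h, hh, hcomp⟩ := hH (Ψ.toChart.symm z).proj
    have hzo : z ∈ AdaptedChart.overlap Ψ φ.normalAdapted :=
      ⟨hz, (φ.normalAdapted_mem_source _).2 hx⟩
    have ht := AdaptedChart.change_mem_target Ψ φ.normalAdapted hzo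
    refine (AdaptedChart.cyclicDeriv_of_overlap Ψ φ.normalAdapted
      (hasSmoothComponents_fundamentalForm hD hg hφ) (hasBasicComponents_fundamentalForm hD hg hφ)
      (fun w hw a b => ?_) hzo a b c).trans
      (cyclicDeriv_fundamentalForm_eq_zero hD hg hφ ht (fun a b c => ?_) _ _ _)
    · rw [component_fundamentalForm hD g hφ hw, component_fundamentalForm hD g hφ hw,
        hg.component_comm φ _ a.1, hg.component_comm φ _ a.2]
      ring
    · set y := AdaptedChart.change Ψ φ.normalAdapted z
      have hy := φ.base_mem_target ht
      have hopen : IsOpen (Prod.snd '' φ.toChart.target) :=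
        isOpenMap_snd _ φ.toChart.open_target
      have hhy : ContDiffAt ℝ ∞ h y.2.1 := hh.contDiffAt (hopen.mem_nhds ⟨_, hy, rfl⟩)
      -- The transverse derivatives of the metric are third derivatives of the potential `h`.
      have key : ∀ a b c : Q, fderiv ℝ (fun w => φ.component g w a b) (y.1, y.2.1) (0, c) =
          fderiv ℝ (fun y => fderiv ℝ (fderiv ℝ h) y a b) y.2.1 c := by
        intro a b c
        have hE : (fun w => φ.component g w a b) =ᶠ[𝓝 (y.1, y.2.1)]
            (fun y => fderiv ℝ (fderiv ℝ h) y a b) ∘ Prod.snd := by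
          filter_upwards [φ.toChart.open_target.mem_nhds hy] with w hw
          exact hcomp w hw a b
        have hd : DifferentiableAt ℝ (fun y => fderiv ℝ (fderiv ℝ h) y a b) y.2.1 :=
          ((((hhy.fderiv_right (m := ∞) (by simp)).fderiv_right (m := ∞) (by simp)).clm_apply
            contDiffAt_const).clm_apply contDiffAt_const).differentiableAt (by simp)
        rw [hE.fderiv_eq, (hd.hasFDerivAt.comp (f := Prod.snd) (y.1, y.2.1)
          hasFDerivAt_snd).fderiv]
        rfl
      rw [key, key]
      exact fderiv_hessian_swap hhy a b c

set_option synthInstance.maxHeartbeats 200000 in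
theorem IsFoliatedKahler.isFoliatedHessian (hD : F.IsFoliatedFlat D) {g : F.NormalForm}
    (hg : F.IsFoliatedMetric g)
    (hK : F.normalFoliation.IsFoliatedKahler (normalJ hD) (liftedMetric hD g)) :
    F.IsFoliatedHessian D g := by
  refine ⟨hg, fun x => ?_⟩
  obtain ⟨φ, hx, hφ⟩ := hD x
  set z := φ.toChart x with hz_def
  -- Shrinking to a ball provides a convex transverse domain for the Poincaré lemma and makes `g` a
  -- function of `y` alone on the whole domain.
  obtain ⟨r, hr, hball⟩ :=
    Metric.isOpen_iff.1 φ.toChart.open_target z (φ.toChart.map_source hx)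
  have hU : IsOpen (Metric.ball z r) := Metric.isOpen_ball
  have hmem : ∀ y ∈ Metric.ball z.2 r, (z.1, y) ∈ φ.toChart.target := fun y hy => hball (by
    rw [Metric.mem_ball, Prod.dist_eq, max_lt_iff]
    exact ⟨by simpa using hr, hy⟩)
  have htarget : (φ.restrictTarget _ hU).toChart.target = Metric.ball z r := by
    rw [φ.restrictTarget_target hU, inter_eq_right.2 hball]
  have hsnd : Prod.snd '' (φ.restrictTarget _ hU).toChart.target ⊆ Metric.ball z.2 r := by
    rw [htarget]
    rintro _ ⟨w, hw, rfl⟩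
    rw [Metric.mem_ball, Prod.dist_eq, max_lt_iff] at hw
    exact hw.2
  have hs : φ.HasSmoothComponents g := hg.smooth φ
  -- Freezing the leaf coordinate at `z.1` turns the metric into a field of bilinear forms on a ball
  -- of `Q`; `component_eq_of_ball` later recovers the other leaf coordinates.
  have hG : ContDiffOn ℝ ∞ (fun y => φ.componentL g (z.1, y)) (Metric.ball z.2 r) :=
    hs.contDiffOn_componentL.comp (contDiff_const.prodMk contDiff_id).contDiffOn hmem
  have hfd : ∀ y ∈ Metric.ball z.2 r, ∀ a b c,
      fderiv ℝ (fun y => φ.componentL g (z.1, y)) y c a b =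
        fderiv ℝ (fun w => φ.component g w a b) (z.1, y) (0, c) := by
    intro y hy a b c
    have hd : DifferentiableAt ℝ (φ.componentL g) (z.1, y) :=
      (hs.contDiffOn_componentL.contDiffAt
        (φ.toChart.open_target.mem_nhds (hmem y hy))).differentiableAt (by simp)
    have h := HasFDerivAt.comp (g := φ.componentL g) (f := fun y : Q => (z.1, y)) y
      hd.hasFDerivAt (hasFDerivAt_prodMk_right (𝕜 := ℝ) z.1 y)
    rw [HasFDerivAt.fderiv (f := fun y => φ.componentL g (z.1, y)) h,
      hs.fderiv_component (hmem y hy)]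
    rfl
  obtain ⟨h, hh, hhess⟩ := exists_hessian_eq (convex_ball z.2 r) Metric.isOpen_ball hG
    (fun y _ a b => hg.component_comm φ _ a b) fun y hy a b => by
      ext c
      rw [hfd y hy, hfd y hy]
      exact fderiv_component_swap_of_closed hD hg hφ hK.closed (hmem y hy) b c a
  refine ⟨φ.restrictTarget _ hU,
    φ.mem_restrictTarget_source hU hx (Metric.mem_ball_self hr), hφ.restrictTarget hU,
    h, hh.mono hsnd, fun w hw a b => ?_⟩
  rw [φ.component_restrictTarget hU, hhess w.2 (hsnd ⟨w, hw, rfl⟩),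
    hg.component_eq_of_ball φ hball (htarget ▸ hw)]
  rfl

end HessianKahler

end Foliation

end

theorem mainTheorem2 {p q : ℕ} {M : Type*} [TopologicalSpace M]
    [ChartedSpace (EuclideanSpace ℝ (Fin (p + q))) M]
    [IsManifold (𝓡 (p + q)) ∞ M]
    (F : Foliation (𝓡 (p + q)) M
      (EuclideanSpace ℝ (Fin p)) (EuclideanSpace ℝ (Fin q)))
    (D : CovariantDerivative (𝓡 (p + q))
      (EuclideanSpace ℝ (Fin q)) F.NormalSpace)
    (hD : F.IsFoliatedFlat D)
    (g : F.NormalForm) (hg : F.IsFoliatedMetric g) :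
    F.IsFoliatedHessian D g ↔
      F.normalFoliation.IsFoliatedKahler (Foliation.normalJ hD) (Foliation.liftedMetric hD g) :=
  ⟨fun hH => hH.isFoliatedKahler hD, fun hK => hK.isFoliatedHessian hD hg⟩
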